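/- Say that a Borel probability distribution $D$ on $\mathbb{R}^n$ is \emph{$k$-clusterable} if there are $c_1,\dots,c_k\in\mathbb{R}^n$ such that the support of $D$ is contained in $\bigcup_{i=1}^k \{y : \|y-c_i\|_2\le 1\}$, and \emph{$\varepsilon$-far from $k$-clusterable} if the total variation distance between $D$ and every $k$-clusterable probability distribution on $\mathbb{R}^n$ is at least $\varepsilon$. A (two-sided) \emph{$\varepsilon$-tester for $k$-clusterability in $\mathbb{R}^n$ with sample complexity $m$} is a randomized algorithm that, given $m$ independent samples from an unknown probability distribution $D$ on $\mathbb{R}^n$, outputs $1$ with probability at least $2/3$ whenever $D$ is $k$-clusterable, and outputs $0$ with probability at least $2/3$ whenever $D$ is $\varepsilon$-far from $k$-clusterable. Theorem. For every sufficiently small constant $\varepsilon>0$, every $\varepsilon$-tester for $k$-clusterability in $\mathbb{R}^n$ has sample complexity $\Omega\!\left(\frac{nk}{\log(nk)}\right)$. That is, there are absolute constants $\varepsilon_0>0$ and $c>0$ such that for all $0<\varepsilon\le\varepsilon_0$, all positive integers $n,k$ with $nk\ge 2$, and every $m$, if there is an $\varepsilon$-tester for $k$-clusterability in $\mathbb{R}^n$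 with sample complexity $m$, then $m\ge c\,\frac{nk}{\log(nk)}$. -/

import Mathlib

open MeasureTheory ProbabilityTheory

namespace Clusterability

/-- Euclidean space `ℝⁿ` (with the Euclidean norm and the Borel σ-algebra). -/
abbrev Space (n : ℕ) : Type := EuclideanSpace ℝ (Fin n)

/-- A distribution `D` on `ℝⁿ` is `k`-clusterable if its support is covered by `k` closed balls of
radius `1` (the centers need not be distinct, so this is the same as at most `k` balls). -/
def IsClusterable {n : ℕ} (k : ℕ) (D : Measure (Space n)) : Prop :=
  ∃ c : Fin k → Space n, D.support ⊆ ⋃ i, Metric.closedBall (c i) 1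

/-- The total variation distance `sup_S |μ(S) - ν(S)|`, over all measurable sets `S`. It is used
for probability measures only, where the supremum is over a subset of `[0, 1]`. -/
noncomputable def tvDist {α : Type*} [MeasurableSpace α] (μ ν : Measure α) : ℝ :=
  ⨆ S : {S : Set α // MeasurableSet S}, |μ.real S.1 - ν.real S.1|

/-- `D` is `ε`-far from `k`-clusterable if its total variation distance to every `k`-clusterable
probability distribution on `ℝⁿ` is at least `ε`. -/
def IsFarFromClusterable {n : ℕ} (k : ℕ) (ε : ℝ) (D : Measure (Space n)) : Prop :=
  ∀ D' : Measure (Space n), IsProbabilityMeasure D' → IsClusterable k D' → ε ≤ tvDist D D'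

/-- A randomized algorithm that draws `m` samples in `ℝⁿ` and outputs a bit: for each sequence of
sample points, `A x` is the law of the output over the internal randomness of the algorithm.
No bound is put on the running time. -/
abbrev SampleAlgorithm (n m : ℕ) : Type := Kernel (Fin m → Space n) Bool

/-- The probability that `A` outputs `b` on `m` independent samples from `D`, over both the samples
and the internal randomness of `A`. -/
noncomputable def outputProb {n m : ℕ} (A : SampleAlgorithm n m) (D : Measure (Space n))
    (b : Bool) : ℝ :=
  ((Measure.pi fun _ : Fin m => D).bind A).real {b}

/-- `A` is a (two-sided, distribution-free) `ε`-tester for `k`-clusterability in `ℝⁿ` that uses `m`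
samples; `true` and `false` stand for the outputs `1` and `0`. -/
structure IsTester (n k : ℕ) (ε : ℝ) {m : ℕ} (A : SampleAlgorithm n m) : Prop where
  isMarkovKernel : IsMarkovKernel A
  accepts : ∀ D : Measure (Space n), IsProbabilityMeasure D →
    IsClusterable k D → 2 / 3 ≤ outputProb A D true
  rejects : ∀ D : Measure (Space n), IsProbabilityMeasure D →
    IsFarFromClusterable k ε D → 2 / 3 ≤ outputProb A D false

end Clusterability

/-! Write `X = nk`. Alternating-sign points of the moment curve, normalised and pushed slightly
outside the unit sphere, give `3n` points in `ℝⁿ` such that any `n` of them fit in one unit ball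
while no unit ball holds more than `2n`. About `3k/4` far-apart copies give `N = Θ(X)` points such
that any `X/4` of them are covered by `k` unit balls, while `k` unit balls never cover more than `2X
≤ 8N/9` (`exists_cluster_points`).

Put independent random weights on these points and normalise. Under a law `p` almost all weights
vanish, so the distribution is typically clusterable. Under a law `q` all weights are at least `1`
with mean at most `3`, so it is typically far. Lagrange interpolation at `0` yields such `p` and `q`
on `[0, 10⁶M²]` agreeing on all polynomials of degree at most `M` (`exists_moment_matching`).

As a function `v` of one weight, the acceptance probability is `A(v)/(S+v)^m`, where `A` has
nonnegative coefficients and `A(v) ≤ (S+v)^m`. A fixed extra weight `N` on one point keeps `S ≥ N`,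
so this function is within `e^{-3(M+1)} exp(O(mM²/X))` of a polynomial of degree `M`
(`exists_polynomial_approx`). Exchanging `p` for `q` one coordinate at a time then changes the mean
acceptance probability by at most `2N` times this error. With `M ≈ log X` and `m` below a small
multiple of `X/log X` the change is less than the gap that a tester must create. -/

namespace Clusterability

/-! ### Means over independent coordinates -/

/-- The mean of `G σ` when the coordinates of `σ` are independent with weights `p`. -/
noncomputable def prodMean {κ : Type*} [Fintype κ] {N : ℕ} (p : κ → ℝ)
    (G : (Fin N → κ) → ℝ) : ℝ :=
  ∑ σ : Fin N → κ, (∏ i, p (σ i)) * G σ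

section ProdMean

variable {κ : Type*} [Fintype κ] {N : ℕ} {p q : κ → ℝ}

lemma prodMean_succ (p : κ → ℝ) (G : (Fin (N + 1) → κ) → ℝ) :
    prodMean p G = ∑ a, p a * prodMean p fun τ : Fin N → κ => G (Fin.cons a τ) := by
  unfold prodMean
  rw [← (Fin.consEquiv fun _ : Fin (N + 1) => κ).sum_comp, Fintype.sum_prod_type]
  refine Finset.sum_congr rfl fun a _ => ?_
  rw [Finset.mul_sum]
  refine Finset.sum_congr rfl fun τ _ => ?_
  simp [Fin.consEquiv, Fin.prod_univ_succ, mul_assoc]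

lemma prodMean_mono (hp : ∀ a, 0 ≤ p a) {G H : (Fin N → κ) → ℝ} (h : ∀ σ, G σ ≤ H σ) :
    prodMean p G ≤ prodMean p H :=
  Finset.sum_le_sum fun σ _ =>
    mul_le_mul_of_nonneg_left (h σ) (Finset.prod_nonneg fun _ _ => hp _)

lemma prodMean_add (p : κ → ℝ) (G H : (Fin N → κ) → ℝ) :
    prodMean p (fun σ => G σ + H σ) = prodMean p G + prodMean p H := by
  simp [prodMean, mul_add, Finset.sum_add_distrib]

lemma prodMean_sub (p : κ → ℝ) (G H : (Fin N → κ) → ℝ) :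
    prodMean p (fun σ => G σ - H σ) = prodMean p G - prodMean p H := by
  simp [prodMean, mul_sub, Finset.sum_sub_distrib]

lemma prodMean_const_mul (p : κ → ℝ) (c : ℝ) (G : (Fin N → κ) → ℝ) :
    prodMean p (fun σ => c * G σ) = c * prodMean p G := by
  unfold prodMean
  rw [Finset.mul_sum]
  exact Finset.sum_congr rfl fun σ _ => by ring

lemma prodMean_const (hp1 : ∑ a, p a = 1) (c : ℝ) :
    prodMean p (fun _ : Fin N → κ => c) = c := by
  induction N with
  | zero => simp [prodMean]
  | succ N ih => simp only [prodMean_succ, ih, ← Finset.sum_mul, hp1, one_mul]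

lemma prodMean_sum (hp1 : ∑ a, p a = 1) (h : κ → ℝ) :
    prodMean p (fun σ : Fin N → κ => ∑ i, h (σ i)) = N * ∑ a, p a * h a := by
  induction N with
  | zero => simp [prodMean]
  | succ N ih =>
    simp only [prodMean_succ, Fin.sum_univ_succ, Fin.cons_zero, Fin.cons_succ, prodMean_add, ih,
      prodMean_const hp1, mul_add, Finset.sum_add_distrib, ← Finset.sum_mul, hp1]
    push_cast
    ring

lemma abs_prodMean_le (hp : ∀ a, 0 ≤ p a) (G : (Fin N → κ) → ℝ) :
    |prodMean p G| ≤ prodMean p fun σ => |G σ| := by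
  refine (Finset.abs_sum_le_sum_abs _ _).trans (Finset.sum_le_sum fun σ _ => ?_)
  rw [abs_mul, abs_of_nonneg (Finset.prod_nonneg fun _ _ => hp _)]

/-- Replacing the weights `p` by `q` one coordinate at a time. -/
lemma abs_prodMean_sub_prodMean_le (hp : ∀ a, 0 ≤ p a) (hq : ∀ a, 0 ≤ q a)
    (hp1 : ∑ a, p a = 1) (hq1 : ∑ a, q a = 1) {δ : ℝ} (G : (Fin N → κ) → ℝ)
    (h : ∀ i σ, |∑ a, (p a - q a) * G (Function.update σ i a)| ≤ δ) :
    |prodMean p G - prodMean q G| ≤ N * δ := by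
  induction N with
  | zero => simp [prodMean]
  | succ N ih =>
    have h1 (a : κ) : |(prodMean p fun τ => G (Fin.cons a τ)) -
        prodMean q fun τ => G (Fin.cons a τ)| ≤ N * δ := by
      refine ih _ fun i τ => ?_
      simpa only [Fin.cons_update] using h i.succ (Fin.cons a τ)
    have h2 : |∑ a, (p a - q a) * prodMean q fun τ => G (Fin.cons a τ)| ≤ δ := by
      have : ∑ a, (p a - q a) * (prodMean q fun τ => G (Fin.cons a τ)) =
          prodMean q fun τ => ∑ a, (p a - q a) * G (Fin.cons a τ) := by
        simp only [prodMean, Finset.mul_sum]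
        rw [Finset.sum_comm]
        exact Finset.sum_congr rfl fun _ _ => Finset.sum_congr rfl fun _ _ => by ring
      rw [this, ← prodMean_const (N := N) hq1 δ]
      refine (abs_prodMean_le hq _).trans (prodMean_mono hq fun τ => ?_)
      rcases isEmpty_or_nonempty κ with hκ | ⟨⟨a₀⟩⟩
      · simp at hp1
      -- Coordinate `0` is overwritten by the update, so the filler `a₀` is arbitrary.
      simpa only [Fin.update_cons_zero] using h 0 (Fin.cons a₀ τ)
    have h3 : prodMean p G - prodMean q G =
        ∑ a, p a * ((prodMean p fun τ => G (Fin.cons a τ)) -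
          prodMean q fun τ => G (Fin.cons a τ)) +
        ∑ a, (p a - q a) * prodMean q fun τ => G (Fin.cons a τ) := by
      rw [prodMean_succ, prodMean_succ, ← Finset.sum_add_distrib, ← Finset.sum_sub_distrib]
      exact Finset.sum_congr rfl fun _ _ => by ring
    have h4 : |∑ a, p a * ((prodMean p fun τ => G (Fin.cons a τ)) -
          prodMean q fun τ => G (Fin.cons a τ))| ≤ N * δ := by
      refine (Finset.abs_sum_le_sum_abs _ _).trans ?_
      calc _ ≤ ∑ a, p a * (N * δ) := Finset.sum_le_sum fun a _ => by
            rw [abs_mul, abs_of_nonneg (hp a)]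
            exact mul_le_mul_of_nonneg_left (h1 a) (hp a)
        _ = N * δ := by rw [← Finset.sum_mul, hp1, one_mul]
    rw [h3]
    refine (abs_add_le _ _).trans ?_
    push_cast
    linarith

end ProdMean

/-! ### Polynomial approximation of the acceptance probability -/

section Approximation

/-- Pascal's rule makes the product telescope: the truncated series of `(1 + u)^{-(m+1)}` becomes
that of `(1 + u)^{-m}` plus one boundary term. This recursion in `m` drives both estimates below. -/
lemma one_add_mul_sum_multichoose (m R : ℕ) (u : ℝ) :
    (1 + u) * ∑ r ∈ Finset.range (R + 1), (Nat.multichoose (m + 1) r : ℝ) * (-u) ^ r =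
      ∑ r ∈ Finset.range (R + 1), (Nat.multichoose m r : ℝ) * (-u) ^ r +
        u * ((Nat.multichoose (m + 1) R : ℝ) * (-u) ^ R) := by
  induction R with
  | zero => simp
  | succ R ih =>
    rw [Finset.sum_range_succ, mul_add, ih, Finset.sum_range_succ _ (R + 1),
      Nat.multichoose_succ_succ]
    push_cast
    ring

/-- The Taylor remainder of `(1 + u)⁻ᵐ`. -/
lemma inv_pow_sub_sum_multichoose (m R : ℕ) {u : ℝ} (hu : 0 ≤ u) :
    0 ≤ (-1) ^ R * (((1 + u) ^ m)⁻¹ -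
        ∑ r ∈ Finset.range R, (Nat.multichoose m r : ℝ) * (-u) ^ r) ∧
      (-1) ^ R * (((1 + u) ^ m)⁻¹ -
        ∑ r ∈ Finset.range R, (Nat.multichoose m r : ℝ) * (-u) ^ r) ≤
        Nat.multichoose m R * u ^ R := by
  induction m generalizing R with
  | zero =>
    cases R with
    | zero => simp
    | succ R => simp [Finset.sum_range_succ']
  | succ m ih =>
    cases R with
    | zero =>
      simp only [pow_zero, Finset.range_zero, Finset.sum_empty, sub_zero, one_mul, mul_one,
        Nat.multichoose_zero_right, Nat.cast_one]
      exact ⟨by positivity, inv_le_one_of_one_le₀ (one_le_pow₀ (by linarith))⟩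
    | succ R =>
      have hpos : 0 < 1 + u := by linarith
      have key : (1 + u) * ((-1) ^ (R + 1) * (((1 + u) ^ (m + 1))⁻¹ -
          ∑ r ∈ Finset.range (R + 1), (Nat.multichoose (m + 1) r : ℝ) * (-u) ^ r)) =
          (-1) ^ (R + 1) * (((1 + u) ^ m)⁻¹ -
            ∑ r ∈ Finset.range (R + 1), (Nat.multichoose m r : ℝ) * (-u) ^ r) +
          Nat.multichoose (m + 1) R * u ^ (R + 1) := by
        have h1 := one_add_mul_sum_multichoose m R u
        have h2 : (1 + u) * ((1 + u) ^ (m + 1))⁻¹ = ((1 + u) ^ m)⁻¹ := by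
          rw [pow_succ', mul_inv, mul_inv_cancel_left₀ hpos.ne']
        have h3 : ((-1 : ℝ)) ^ R * (-1) ^ R = 1 := by rw [← mul_pow]; simp
        have h4 : (-u) ^ R = (-1) ^ R * u ^ R := by rw [← mul_pow]; simp
        rw [mul_left_comm, mul_sub, h1, h2, h4]
        linear_combination (Nat.multichoose (m + 1) R * u ^ (R + 1) : ℝ) * h3
      obtain ⟨ih1, ih2⟩ := ih (R + 1)
      have hc : (0 : ℝ) ≤ Nat.multichoose (m + 1) R * u ^ (R + 1) := by positivity
      constructor
      · refine nonneg_of_mul_nonneg_right ?_ hpos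
        rw [key]; linarith
      · have h0 : 0 ≤ (-1) ^ (R + 1) * (((1 + u) ^ (m + 1))⁻¹ -
          ∑ r ∈ Finset.range (R + 1), (Nat.multichoose (m + 1) r : ℝ) * (-u) ^ r) := by
          refine nonneg_of_mul_nonneg_right ?_ hpos
          rw [key]; linarith
        rw [Nat.multichoose_succ_succ]
        push_cast
        nlinarith

/-- The left side is one term of the expansion of `(1 - x)^{-m}`, all of whose terms are
nonnegative. -/
lemma multichoose_mul_pow_le (m R : ℕ) {x : ℝ} (hx : 0 ≤ x) (hx1 : x < 1) :
    (Nat.multichoose m R : ℝ) * x ^ R ≤ ((1 - x) ^ m)⁻¹ := by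
  have hpos : 0 < 1 - x := by linarith
  have key : (1 - x) ^ m * ∑ r ∈ Finset.range (R + 1), (Nat.multichoose m r : ℝ) * x ^ r ≤ 1 := by
    induction m with
    | zero => simp [Finset.sum_range_succ']
    | succ m ih =>
      have h := one_add_mul_sum_multichoose m R (-x)
      simp only [neg_neg, ← sub_eq_add_neg] at h
      rw [pow_succ, mul_assoc, h, mul_add]
      have : 0 ≤ (1 - x) ^ m * (x * ((Nat.multichoose (m + 1) R : ℝ) * x ^ R)) := by positivity
      linarith
  have h1 : (Nat.multichoose m R : ℝ) * x ^ R ≤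
      ∑ r ∈ Finset.range (R + 1), (Nat.multichoose m r : ℝ) * x ^ r :=
    Finset.single_le_sum (f := fun r => (Nat.multichoose m r : ℝ) * x ^ r)
      (fun _ _ => by positivity) (Finset.self_mem_range_succ R)
  rw [← one_div, le_div_iff₀' (by positivity)]
  exact (mul_le_mul_of_nonneg_left h1 (by positivity)).trans key

open Polynomial in
/-- A rational function `A(v) / (S + v)ᵐ`, where `A` has nonnegative coefficients and is dominated
by `(S + v)ᵐ`, is close to a polynomial of degree `L` on `[0, lam]`. -/
lemma exists_polynomial_approx {A : ℝ[X]} (hA : ∀ j, 0 ≤ A.coeff j) {S : ℝ} (hS : 0 < S)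
    {m : ℕ} (L : ℕ) (hAS : ∀ x, 0 ≤ x → A.eval x ≤ (S + x) ^ m) {r lam : ℝ} (hr : 0 < r)
    (hr1 : r ≤ 1) (hlam : lam < r * S) :
    ∃ P : ℝ[X], P.natDegree ≤ L ∧ ∀ v, 0 ≤ v → v ≤ lam →
      |A.eval v / (S + v) ^ m - P.eval v| ≤
        r ^ (L + 1) * ((1 + lam / (r * S)) / (1 - lam / (r * S))) ^ m := by
  set D := A.natDegree + 1
  -- Each monomial `v^j` of `A` gets its own Taylor truncation of `(1 + v/S)^{-m}`, cut so that the
  -- product has degree at most `L`. For `j > L` the natural subtraction gives `0`, and the monomial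
  -- is dropped.
  refine ⟨∑ j ∈ Finset.range D, C (A.coeff j * (S ^ m)⁻¹) * X ^ j *
    ∑ i ∈ Finset.range (L + 1 - j), C ((Nat.multichoose m i : ℝ) * (-S⁻¹) ^ i) * X ^ i, ?_, ?_⟩
  · refine natDegree_sum_le_of_forall_le _ _ fun j _ => ?_
    rcases le_or_gt j L with hj | hj
    · refine (natDegree_mul_le (p := C (A.coeff j * (S ^ m)⁻¹) * X ^ j)).trans ?_
      have h1 := natDegree_C_mul_X_pow_le (A.coeff j * (S ^ m)⁻¹) j
      have h2 : (∑ i ∈ Finset.range (L + 1 - j),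
          C ((Nat.multichoose m i : ℝ) * (-S⁻¹) ^ i) * X ^ i).natDegree ≤ L - j := by
        refine natDegree_sum_le_of_forall_le _ _ fun i hi => ?_
        refine (natDegree_C_mul_X_pow_le _ _).trans ?_
        rw [Finset.mem_range] at hi
        omega
      omega
    · have : L + 1 - j = 0 := by omega
      simp [this]
  · intro v hv hvl
    have hrS : 0 < r * S := by positivity
    set z := lam / (r * S) with hz
    have hz1 : z < 1 := by rw [hz, div_lt_one hrS]; exact hlam
    have hSm : 0 < S ^ m := by positivity
    have hx0 : 0 ≤ v / r := by positivity
    have hxz : v / r / S ≤ z := by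
      rw [hz, div_div]; gcongr
    have hxS0 : 0 ≤ v / r / S := by positivity
    have hexp : A.eval v / (S + v) ^ m =
        ∑ j ∈ Finset.range D, A.coeff j * (S ^ m)⁻¹ * v ^ j * ((1 + v / S) ^ m)⁻¹ := by
      have : (S + v) ^ m = S ^ m * (1 + v / S) ^ m := by
        rw [← mul_pow]; congr 1; field_simp
      rw [eval_eq_sum_range' (Nat.lt_succ_self _), this, Finset.sum_div]
      refine Finset.sum_congr rfl fun j _ => ?_
      rw [div_eq_mul_inv, mul_inv]; ring
    rw [hexp, eval_finsetSum, ← Finset.sum_sub_distrib]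
    have hterm (j : ℕ) : |A.coeff j * (S ^ m)⁻¹ * v ^ j * ((1 + v / S) ^ m)⁻¹ -
        (C (A.coeff j * (S ^ m)⁻¹) * X ^ j * ∑ i ∈ Finset.range (L + 1 - j),
          C ((Nat.multichoose m i : ℝ) * (-S⁻¹) ^ i) * X ^ i).eval v| ≤
        A.coeff j * (v / r) ^ j * ((S ^ m)⁻¹ * r ^ (L + 1) * ((1 - z) ^ m)⁻¹) := by
      set R := L + 1 - j
      have he : A.coeff j * (S ^ m)⁻¹ * v ^ j * ((1 + v / S) ^ m)⁻¹ -
        (C (A.coeff j * (S ^ m)⁻¹) * X ^ j * ∑ i ∈ Finset.range R,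
          C ((Nat.multichoose m i : ℝ) * (-S⁻¹) ^ i) * X ^ i).eval v =
          A.coeff j * (S ^ m)⁻¹ * v ^ j * (((1 + v / S) ^ m)⁻¹ -
            ∑ i ∈ Finset.range R, (Nat.multichoose m i : ℝ) * (-(v / S)) ^ i) := by
        simp only [eval_mul, eval_C, eval_pow, eval_X, eval_finsetSum]
        rw [mul_sub]
        congr 2
        refine Finset.sum_congr rfl fun i _ => ?_
        rw [mul_assoc, ← mul_pow]
        congr 2
        rw [div_eq_mul_inv]; ring
      obtain ⟨b1, b2⟩ := inv_pow_sub_sum_multichoose m R (u := v / S) (by positivity)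
      have hc : 0 ≤ A.coeff j * (S ^ m)⁻¹ * v ^ j :=
        mul_nonneg (mul_nonneg (hA j) (by positivity)) (by positivity)
      have habs : |((1 + v / S) ^ m)⁻¹ -
          ∑ i ∈ Finset.range R, (Nat.multichoose m i : ℝ) * (-(v / S)) ^ i| ≤
          Nat.multichoose m R * (v / S) ^ R := by
        have := abs_of_nonneg b1
        rw [abs_mul, abs_pow, abs_neg, abs_one, one_pow, one_mul] at this
        rw [this]; exact b2
      rw [he, abs_mul, abs_of_nonneg hc]
      refine (mul_le_mul_of_nonneg_left habs hc).trans ?_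
      -- Passing from `v` to `v/r` gains `r^{j+R}` with `j + R ≥ L + 1`, for every `j`. The price is
      -- that `A` and the series are bounded at `v/r` instead of `v`.
      have h1 : v ^ j * (v / S) ^ R = r ^ (j + R) * ((v / r) ^ j * (v / r / S) ^ R) := by
        rw [pow_add, mul_mul_mul_comm, ← mul_pow, ← mul_pow]
        congr 2 <;> field_simp
      have h2 : r ^ (j + R) ≤ r ^ (L + 1) := pow_le_pow_of_le_one hr.le hr1 (by omega)
      have h3 : (Nat.multichoose m R : ℝ) * (v / r / S) ^ R ≤ ((1 - z) ^ m)⁻¹ := by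
        refine (multichoose_mul_pow_le m R hxS0 (hxz.trans_lt hz1)).trans ?_
        have : 0 < 1 - z := by linarith
        gcongr
      have hcj := hA j
      calc A.coeff j * (S ^ m)⁻¹ * v ^ j * (Nat.multichoose m R * (v / S) ^ R)
          = A.coeff j * (v / r) ^ j * ((S ^ m)⁻¹ * r ^ (j + R) *
              (Nat.multichoose m R * (v / r / S) ^ R)) := by
            linear_combination (A.coeff j * (S ^ m)⁻¹ * Nat.multichoose m R) * h1
        _ ≤ _ := by gcongr
    refine (Finset.abs_sum_le_sum_abs _ _).trans ((Finset.sum_le_sum fun j _ => hterm j).trans ?_)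
    rw [← Finset.sum_mul, ← eval_eq_sum_range' (Nat.lt_succ_self _)]
    have h1z : 0 < 1 - z := by linarith
    have hAx : A.eval (v / r) ≤ S ^ m * (1 + z) ^ m := by
      refine (hAS _ hx0).trans ?_
      rw [← mul_pow]
      refine pow_le_pow_left₀ (by positivity) ?_ m
      have := mul_le_mul_of_nonneg_left hxz hS.le
      rw [mul_div_cancel₀ _ hS.ne'] at this
      linarith
    calc _ ≤ S ^ m * (1 + z) ^ m * ((S ^ m)⁻¹ * r ^ (L + 1) * ((1 - z) ^ m)⁻¹) := by gcongr
      _ = _ := by rw [div_pow]; field_simp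

end Approximation

/-! ### Two laws with matching moments -/

section Moments

/-- The nonzero nodes `1, 1000, 10⁶, 10⁶ · 2², 10⁶ · 3², …`. -/
noncomputable def node : ℕ → ℝ
  | 0 => 1
  | 1 => 1000
  | i + 2 => 10 ^ 6 * ((i : ℝ) + 1) ^ 2

/-- The value at `0` of the Lagrange basis polynomials of the first `M + 2` nodes. -/
noncomputable def nodeCoeff (M i : ℕ) : ℝ :=
  ∏ j ∈ Finset.range (M + 2), if j = i then 1 else node j / (node j - node i)

lemma one_le_sq_succ (i : ℕ) : 1 ≤ ((i : ℝ) + 1) ^ 2 := one_le_pow₀ (by simp)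

lemma node_strictMono : StrictMono node := by
  refine strictMono_nat_of_lt_succ fun i => ?_
  match i with
  | 0 => norm_num [node]
  | 1 => norm_num [node]
  | i + 2 =>
    simp only [node]
    gcongr
    simp

lemma one_le_node (i : ℕ) : 1 ≤ node i := node_strictMono.monotone (Nat.zero_le i)

lemma eval_zero_eq_sum_nodeCoeff {M : ℕ} {P : Polynomial ℝ} (hP : P.natDegree ≤ M) :
    P.eval 0 = ∑ i ∈ Finset.range (M + 2), nodeCoeff M i * P.eval (node i) := by
  have hinj : Set.InjOn node (Finset.range (M + 2)) := node_strictMono.injective.injOn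
  have hdeg : P.degree < (Finset.range (M + 2)).card := by
    rw [Finset.card_range]
    refine Polynomial.degree_le_natDegree.trans_lt ?_
    exact_mod_cast (by omega : P.natDegree < M + 2)
  conv_lhs => rw [Lagrange.eq_interpolate hinj hdeg]
  rw [Lagrange.interpolate_apply, Polynomial.eval_finsetSum]
  refine Finset.sum_congr rfl fun i hi => ?_
  rw [Polynomial.eval_mul, Polynomial.eval_C, mul_comm]
  congr 1
  rw [Lagrange.basis, Polynomial.eval_prod, nodeCoeff, ← Finset.mul_prod_erase _ _ hi, if_pos rfl,
    one_mul]
  refine Finset.prod_congr rfl fun j hj => ?_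
  rw [if_neg (Finset.ne_of_mem_erase hj), Lagrange.basisDivisor]
  simp only [Polynomial.eval_mul, Polynomial.eval_C, Polynomial.eval_sub, Polynomial.eval_X]
  rw [← neg_sub (node j), inv_neg, zero_sub, neg_mul_neg, div_eq_inv_mul]

lemma sum_inv_sq_le (M : ℕ) : ∑ j ∈ Finset.range M, (((j : ℝ) + 1) ^ 2)⁻¹ ≤ 2 := by
  have key : ∑ j ∈ Finset.range M, (((j : ℝ) + 1) ^ 2)⁻¹ ≤ 2 - ((M : ℝ) + 1 / 2)⁻¹ := by
    induction M with
    | zero => norm_num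
    | succ M ih =>
      rw [Finset.sum_range_succ]
      -- Telescoping, since `(M + 1/2)(M + 3/2) ≤ (M + 1)²`.
      have h : (((M : ℝ) + 1) ^ 2)⁻¹ ≤ ((M : ℝ) + 1 / 2)⁻¹ - (((M + 1 : ℕ) : ℝ) + 1 / 2)⁻¹ := by
        push_cast
        rw [inv_sub_inv (by positivity) (by positivity), ← one_div,
          div_le_div_iff₀ (by positivity) (by positivity)]
        nlinarith
      linarith
  have : 0 ≤ ((M : ℝ) + 1 / 2)⁻¹ := by positivity
  linarith

/-- The nodes from `10⁶` on grow quadratically, so for `a ≤ 1000` the inverse of the product is at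
least `1 - (a/10⁶) ∑ 1/(j+1)²`, uniformly in `M`. -/
lemma prod_node_div_le (M : ℕ) {a : ℝ} (ha : 0 ≤ a) (ha1 : a ≤ 1000) :
    0 ≤ ∏ j ∈ Finset.range M, node (j + 2) / (node (j + 2) - a) ∧
      ∏ j ∈ Finset.range M, node (j + 2) / (node (j + 2) - a) ≤ 1.01 := by
  set t := a / 10 ^ 6 with ht
  have ht0 : 0 ≤ t := by positivity
  have ht1 : t ≤ 1 / 1000 := by rw [ht, div_le_iff₀ (by norm_num)]; linarith
  have hfac (j : ℕ) : 0 ≤ t * (((j : ℝ) + 1) ^ 2)⁻¹ ∧ t * (((j : ℝ) + 1) ^ 2)⁻¹ ≤ 1 / 1000 :=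
    ⟨by positivity, (mul_le_of_le_one_right ht0 (inv_le_one_of_one_le₀ (one_le_sq_succ j))).trans
      ht1⟩
  have key : 1 - t * ∑ j ∈ Finset.range M, (((j : ℝ) + 1) ^ 2)⁻¹ ≤
      ∏ j ∈ Finset.range M, (1 - t * (((j : ℝ) + 1) ^ 2)⁻¹) ∧
      ∏ j ∈ Finset.range M, (1 - t * (((j : ℝ) + 1) ^ 2)⁻¹) ≤ 1 := by
    induction M with
    | zero => simp
    | succ M ih =>
      rw [Finset.prod_range_succ, Finset.sum_range_succ, mul_add]
      have h0 : 0 ≤ ∏ j ∈ Finset.range M, (1 - t * (((j : ℝ) + 1) ^ 2)⁻¹) :=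
        Finset.prod_nonneg fun j _ => by linarith [(hfac j).2]
      obtain ⟨f0, f1⟩ := hfac M
      constructor <;> nlinarith [ih.1, ih.2]
  have heq : ∏ j ∈ Finset.range M, node (j + 2) / (node (j + 2) - a) =
      (∏ j ∈ Finset.range M, (1 - t * (((j : ℝ) + 1) ^ 2)⁻¹))⁻¹ := by
    rw [← Finset.prod_inv_distrib]
    refine Finset.prod_congr rfl fun j _ => ?_
    have h1 := one_le_sq_succ j
    have : node (j + 2) - a = node (j + 2) * (1 - t * (((j : ℝ) + 1) ^ 2)⁻¹) := by
      simp only [node, ht]; field_simp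
    rw [this, ← div_div, div_self (by simp only [node]; positivity), one_div]
  have hs := sum_inv_sq_le M
  have hlow : 1 - 2 / 1000 ≤ ∏ j ∈ Finset.range M, (1 - t * (((j : ℝ) + 1) ^ 2)⁻¹) := by
    nlinarith [key.1]
  rw [heq]
  constructor
  · exact inv_nonneg.2 (by linarith)
  · calc _ ≤ (1 - 2 / 1000 : ℝ)⁻¹ := inv_anti₀ (by norm_num) hlow
      _ ≤ _ := by norm_num

lemma nodeCoeff_zero (M : ℕ) : 0 ≤ nodeCoeff M 0 ∧ nodeCoeff M 0 ≤ 1.02 := by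
  obtain ⟨h0, h1⟩ := prod_node_div_le M (a := 1) (by norm_num) (by norm_num)
  have : nodeCoeff M 0 =
      (∏ j ∈ Finset.range M, node (j + 2) / (node (j + 2) - 1)) * (1000 / 999) := by
    rw [nodeCoeff, Finset.prod_range_succ', Finset.prod_range_succ']
    norm_num [node]
  rw [this]
  constructor <;> norm_num at * <;> linarith

lemma abs_nodeCoeff_one (M : ℕ) : |nodeCoeff M 1| ≤ 1.01 / 999 := by
  obtain ⟨h0, h1⟩ := prod_node_div_le M (a := 1000) (by norm_num) (by norm_num)
  have : nodeCoeff M 1 =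
      (∏ j ∈ Finset.range M, node (j + 2) / (node (j + 2) - 1000)) * (-1 / 999) := by
    rw [nodeCoeff, Finset.prod_range_succ', Finset.prod_range_succ']
    norm_num [node]
  rw [this, abs_mul, abs_of_nonneg h0]
  norm_num at *
  linarith

open Nat in
-- With `t = i + 1` and `M = i + 1 + d`, factoring `s² - t² = (s - t)(s + t)` evaluates the product
-- as `2 (M!)² / ((M - t)! (M + t)!)`.
lemma prod_sq_div_sub_sq (i d : ℕ) :
    (∏ j ∈ Finset.range (i + 1 + d), if j = i then (1 : ℝ) else
      |((j : ℝ) + 1) ^ 2 / (((j : ℝ) + 1) ^ 2 - ((i : ℝ) + 1) ^ 2)|) *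
      (d ! * (2 * (i + 1) + d)!) = 2 * ((i + 1 + d)! : ℝ) ^ 2 := by
  induction d with
  | zero =>
    have h1 : ∏ j ∈ Finset.range i, (if j = i then (1 : ℝ) else
        |((j : ℝ) + 1) ^ 2 / (((j : ℝ) + 1) ^ 2 - ((i : ℝ) + 1) ^ 2)|) =
        ∏ j ∈ Finset.range i, ((j : ℝ) + 1) ^ 2 / (((i - j : ℕ) : ℝ) * ((i + 2 + j : ℕ) : ℝ)) := by
      refine Finset.prod_congr rfl fun j hj => ?_
      rw [Finset.mem_range] at hj
      rw [if_neg hj.ne, abs_div, abs_of_nonneg (by positivity), abs_sub_comm, abs_of_nonneg,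
        Nat.cast_sub hj.le]
      · congr 1; push_cast; ring
      · have : (j : ℝ) ≤ i := by exact_mod_cast hj.le
        nlinarith
    have h2 : ∏ j ∈ Finset.range i, ((j : ℝ) + 1) ^ 2 = (i ! : ℝ) ^ 2 := by
      rw [Finset.prod_pow, ← Finset.prod_range_add_one_eq_factorial]
      push_cast; rfl
    have h3 : ∏ j ∈ Finset.range i, ((i - j : ℕ) : ℝ) = i ! := by
      rw [← Nat.cast_prod, ← Nat.descFactorial_eq_prod_range, Nat.descFactorial_self]
    have h4 : ((i + 1)! : ℝ) * ∏ j ∈ Finset.range i, ((i + 2 + j : ℕ) : ℝ) = (i + 1 + i)! := by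
      rw [← Nat.cast_prod, ← Nat.ascFactorial_eq_prod_range, ← Nat.cast_mul,
        Nat.factorial_mul_ascFactorial]
    have hpos : (0 : ℝ) < ∏ j ∈ Finset.range i, ((i + 2 + j : ℕ) : ℝ) :=
      Finset.prod_pos fun j _ => by positivity
    rw [add_zero, Finset.prod_range_succ, h1, if_pos rfl, Finset.prod_div_distrib,
      Finset.prod_mul_distrib, h2, h3, add_zero, (by ring : 2 * (i + 1) = (i + 1 + i) + 1),
      Nat.factorial_succ (i + 1 + i), Nat.cast_mul, ← h4, Nat.factorial_succ i]
    have : (i ! : ℝ) ≠ 0 := by positivity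
    field_simp
    push_cast [Nat.factorial_zero]
    ring
  | succ d ih =>
    rw [← add_assoc, Finset.prod_range_succ, if_neg (by omega)]
    have h1 : |(((i + 1 + d : ℕ) : ℝ) + 1) ^ 2 /
        ((((i + 1 + d : ℕ) : ℝ) + 1) ^ 2 - ((i : ℝ) + 1) ^ 2)| =
        (((i + 1 + d : ℕ) : ℝ) + 1) ^ 2 / (((d : ℝ) + 1) * (2 * (i + 1) + d + 1)) := by
      rw [abs_div, abs_of_nonneg (by positivity), abs_of_nonneg]
      · congr 1; push_cast; ring
      · push_cast
        have : (0 : ℝ) ≤ d := by positivity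
        have : (0 : ℝ) ≤ i := by positivity
        nlinarith
    rw [h1, ← add_assoc (2 * (i + 1)), Nat.factorial_succ d, Nat.factorial_succ (2 * (i + 1) + d),
      Nat.factorial_succ (i + 1 + d)]
    push_cast at ih ⊢
    have e1 : (0 : ℝ) < (d : ℝ) + 1 := by positivity
    have e2 : (0 : ℝ) < 2 * ((i : ℝ) + 1) + d + 1 := by positivity
    rw [mul_pow, mul_left_comm 2, ← ih]
    field_simp

open Nat in
-- The closed form is twice a ratio of a binomial coefficient of `2M` to the central one.
lemma prod_sq_div_sub_sq_le {M i : ℕ} (hi : i < M) :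
    (∏ j ∈ Finset.range M, if j = i then (1 : ℝ) else
      |((j : ℝ) + 1) ^ 2 / (((j : ℝ) + 1) ^ 2 - ((i : ℝ) + 1) ^ 2)|) ≤ 2 := by
  obtain ⟨d, rfl⟩ := Nat.exists_eq_add_of_lt hi
  rw [show i + d + 1 = i + 1 + d by ring]
  have h1 := prod_sq_div_sub_sq i d
  have h2 : ((i + 1 + d)!) ^ 2 ≤ d ! * (2 * (i + 1) + d)! := by
    have a1 := Nat.choose_le_centralBinom (2 * (i + 1) + d) (i + 1 + d)
    have a2 := Nat.choose_mul_factorial_mul_factorial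
      (by omega : 2 * (i + 1) + d ≤ 2 * (i + 1 + d))
    have a3 := Nat.choose_mul_factorial_mul_factorial
      (by omega : i + 1 + d ≤ 2 * (i + 1 + d))
    rw [show 2 * (i + 1 + d) - (2 * (i + 1) + d) = d by omega] at a2
    rw [show 2 * (i + 1 + d) - (i + 1 + d) = i + 1 + d by omega, ← a2,
      ← Nat.centralBinom_eq_two_mul_choose] at a3
    have hc := Nat.centralBinom_pos (i + 1 + d)
    refine Nat.le_of_mul_le_mul_left ?_ hc
    calc _ = (i + 1 + d).centralBinom * (i + 1 + d)! * (i + 1 + d)! := by ring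
      _ = _ := a3
      _ = (2 * (i + 1 + d)).choose (2 * (i + 1) + d) * (d ! * (2 * (i + 1) + d)!) := by ring
      _ ≤ _ := Nat.mul_le_mul_right _ a1
  have h3 : ((i + 1 + d)! : ℝ) ^ 2 ≤ d ! * (2 * (i + 1) + d)! := by exact_mod_cast h2
  have h4 : (0 : ℝ) < d ! * (2 * (i + 1) + d)! := by positivity
  refine le_of_mul_le_mul_right ?_ h4
  rw [h1]
  linarith

/-- The quadratic nodes alone contribute a bounded factor; each of the nodes `1` and `1000`
contributes a further decay `1/node`. Two such factors are needed for `∑ |nodeCoeff| * node` to stay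
bounded in `M`, which bounds the mean of `q`. -/
lemma abs_nodeCoeff_add_two {M i : ℕ} (hi : i < M) :
    |nodeCoeff M (i + 2)| ≤ 8000 * (node (i + 2) ^ 2)⁻¹ := by
  have h1 : |nodeCoeff M (i + 2)| =
      (∏ j ∈ Finset.range M, if j = i then (1 : ℝ) else
        |((j : ℝ) + 1) ^ 2 / (((j : ℝ) + 1) ^ 2 - ((i : ℝ) + 1) ^ 2)|) *
      (1000 / (node (i + 2) - 1000)) * (1 / (node (i + 2) - 1)) := by
    have hi1 := one_le_sq_succ i
    rw [nodeCoeff, Finset.prod_range_succ', Finset.prod_range_succ', abs_mul, abs_mul,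
      Finset.abs_prod]
    congr 2
    · refine Finset.prod_congr rfl fun j _ => ?_
      rw [apply_ite abs, abs_one]
      simp only [Nat.add_right_cancel_iff]
      split_ifs with h
      · rfl
      · rw [node, node, ← mul_sub, mul_div_mul_left _ _ (by norm_num)]
    · rw [if_neg (by omega), abs_div, abs_sub_comm]
      simp only [node]
      rw [abs_of_nonneg (by norm_num), abs_of_nonneg (by linarith)]
    · rw [if_neg (by omega), abs_div, abs_sub_comm]
      simp only [node]
      rw [abs_of_nonneg (by norm_num), abs_of_nonneg (by linarith)]
  have hN : 10 ^ 6 ≤ node (i + 2) := by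
    have hi1 := one_le_sq_succ i
    simp only [node]; linarith
  rw [h1]
  calc _ ≤ 2 * (1000 / (node (i + 2) / 2)) * (1 / (node (i + 2) / 2)) := by
        have := prod_sq_div_sub_sq_le hi
        have e1 : node (i + 2) / 2 ≤ node (i + 2) - 1000 := by linarith
        have e2 : node (i + 2) / 2 ≤ node (i + 2) - 1 := by linarith
        have e3 : 0 < node (i + 2) / 2 := by linarith
        have e4 : 0 < node (i + 2) - 1 := by linarith
        have e5 : 0 < node (i + 2) - 1000 := by linarith
        gcongr
    _ = _ := by field_simp; norm_num

lemma sum_abs_nodeCoeff_mul_node_le (M : ℕ) :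
    ∑ i ∈ Finset.range (M + 2), |nodeCoeff M i| * node i ≤ 3 := by
  rw [Finset.sum_range_succ', Finset.sum_range_succ', abs_of_nonneg (nodeCoeff_zero M).1]
  have h : ∑ i ∈ Finset.range M, |nodeCoeff M (i + 1 + 1)| * node (i + 1 + 1) ≤ 16 / 1000 := by
    calc _ ≤ ∑ i ∈ Finset.range M, 8 / 1000 * (((i : ℝ) + 1) ^ 2)⁻¹ := by
          refine Finset.sum_le_sum fun i hi => ?_
          have hpos : 0 < node (i + 2) := by linarith [one_le_node (i + 2)]
          calc _ ≤ 8000 * (node (i + 2) ^ 2)⁻¹ * node (i + 2) :=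
                mul_le_mul_of_nonneg_right (abs_nodeCoeff_add_two (Finset.mem_range.1 hi)) hpos.le
            _ = 8000 * (node (i + 2))⁻¹ := by field_simp
            _ = _ := by simp only [node]; rw [mul_inv]; ring
      _ ≤ _ := by rw [← Finset.mul_sum]; linarith [sum_inv_sq_le M]
  have h0 := (nodeCoeff_zero M).2
  have h1 := abs_nodeCoeff_one M
  rw [zero_add, show node 1 = 1000 from rfl, show node 0 = 1 from rfl]
  norm_num at h0 h1 h ⊢
  linarith

lemma sum_abs_nodeCoeff_succ_le (M : ℕ) :
    ∑ i ∈ Finset.range (M + 1), |nodeCoeff M (i + 1)| ≤ 1 / 480 := by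
  rw [Finset.sum_range_succ']
  have h : ∑ i ∈ Finset.range M, |nodeCoeff M (i + 1 + 1)| ≤ 16 / 10 ^ 9 := by
    calc _ ≤ ∑ i ∈ Finset.range M, 8 / 10 ^ 9 * (((i : ℝ) + 1) ^ 2)⁻¹ := by
          refine Finset.sum_le_sum fun i hi => ?_
          refine (abs_nodeCoeff_add_two (Finset.mem_range.1 hi)).trans ?_
          have h1 := one_le_sq_succ i
          have h2 : (((i : ℝ) + 1) ^ 2)⁻¹ ≤ 1 := inv_le_one_of_one_le₀ h1
          have h3 : 0 ≤ (((i : ℝ) + 1) ^ 2)⁻¹ := by positivity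
          simp only [node]
          rw [mul_pow, mul_inv, ← inv_pow (((i : ℝ) + 1) ^ 2)]
          nlinarith
      _ ≤ _ := by rw [← Finset.mul_sum]; linarith [sum_inv_sq_le M]
  have h1 := abs_nodeCoeff_one M
  norm_num at *
  linarith

/-- Two distributions on `[0, 10⁶ M²]` with the same first `M` moments: one is almost concentrated
on `0`, the other one is supported on `[1, ∞)`, and has a bounded mean. -/
lemma exists_moment_matching {M : ℕ} (hM : 1 ≤ M) :
    ∃ y p q : Fin (M + 3) → ℝ, (∀ a, 0 ≤ p a) ∧ (∀ a, 0 ≤ q a) ∧ ∑ a, p a = 1 ∧ ∑ a, q a = 1 ∧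
      y 0 = 0 ∧ (∀ a, a ≠ 0 → 1 ≤ y a) ∧ (∀ a, y a ≤ 10 ^ 6 * (M : ℝ) ^ 2) ∧ q 0 = 0 ∧
      1 - 1 / 480 ≤ p 0 ∧ ∑ a, q a * y a ≤ 3 ∧
      ∀ P : Polynomial ℝ, P.natDegree ≤ M → ∑ a, (p a - q a) * P.eval (y a) = 0 := by
  -- The signed weights `w` express `P(0) = ∑ nodeCoeff * P(node)`. Their positive and negative
  -- parts have the same mass `T`, and divided by `T` they are `p` and `q`.
  set w : Fin (M + 3) → ℝ := Fin.cons 1 fun i : Fin (M + 2) => -nodeCoeff M i with hw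
  set y : Fin (M + 3) → ℝ := Fin.cons 0 fun i : Fin (M + 2) => node i with hy
  set T := ∑ a, max (w a) 0 with hT
  have hmom (P : Polynomial ℝ) (hP : P.natDegree ≤ M) : ∑ a, w a * P.eval (y a) = 0 := by
    rw [Fin.sum_univ_succ]
    simp only [hw, hy, Fin.cons_zero, Fin.cons_succ, one_mul, neg_mul, Finset.sum_neg_distrib]
    rw [Fin.sum_univ_eq_sum_range (fun i => nodeCoeff M i * P.eval (node i)),
      ← eval_zero_eq_sum_nodeCoeff hP, add_neg_cancel]
  have hsplit (a) : max (w a) 0 - max (-w a) 0 = w a := max_zero_sub_max_neg_zero_eq_self _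
  have hT' : ∑ a, max (-w a) 0 = T := by
    have h1 : ∑ a, w a = 0 := by simpa using hmom 1 (by simp)
    have h2 : ∑ a, max (w a) 0 - ∑ a, max (-w a) 0 = 0 := by
      rw [← Finset.sum_sub_distrib, Finset.sum_congr rfl fun a _ => hsplit a, h1]
    linarith
  have hT1 : T = 1 + ∑ i ∈ Finset.range (M + 2), max (-nodeCoeff M i) 0 := by
    rw [hT, Fin.sum_univ_succ]
    simp only [hw, Fin.cons_zero, Fin.cons_succ]
    rw [Fin.sum_univ_eq_sum_range (fun i => max (-nodeCoeff M i) 0)]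
    norm_num
  have hTge : 1 ≤ T := by
    rw [hT1]
    have : 0 ≤ ∑ i ∈ Finset.range (M + 2), max (-nodeCoeff M i) 0 :=
      Finset.sum_nonneg fun _ _ => le_max_right _ _
    linarith
  have hTle : T ≤ 1 + 1 / 480 := by
    -- The large coefficient, that of the node `1`, is nonnegative, so it goes to `q` and adds
    -- nothing to `T` here.
    rw [hT1, Finset.sum_range_succ', max_eq_right (neg_nonpos.2 (nodeCoeff_zero M).1), add_zero]
    have : ∑ i ∈ Finset.range (M + 1), max (-nodeCoeff M (i + 1)) 0 ≤
        ∑ i ∈ Finset.range (M + 1), |nodeCoeff M (i + 1)| :=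
      Finset.sum_le_sum fun _ _ => max_le (neg_le_abs _) (abs_nonneg _)
    linarith [sum_abs_nodeCoeff_succ_le M]
  have hTpos : 0 < T := by linarith
  refine ⟨y, fun a => max (w a) 0 / T, fun a => max (-w a) 0 / T,
    fun a => div_nonneg (le_max_right _ _) hTpos.le,
    fun a => div_nonneg (le_max_right _ _) hTpos.le, ?_, ?_, by simp [hy], ?_, ?_, ?_, ?_, ?_, ?_⟩
  · rw [← Finset.sum_div, div_self hTpos.ne']
  · rw [← Finset.sum_div, hT', div_self hTpos.ne']
  · intro a ha
    obtain ⟨i, rfl⟩ := Fin.exists_succ_eq.2 ha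
    simpa [hy] using one_le_node i
  · intro a
    have hle : (1 : ℝ) ≤ M := by exact_mod_cast hM
    refine Fin.cases ?_ (fun i => ?_) a
    · simp only [hy, Fin.cons_zero]; positivity
    · simp only [hy, Fin.cons_succ]
      have h1 : node i ≤ node (M - 1 + 2) := node_strictMono.monotone (by omega)
      refine h1.trans_eq ?_
      simp only [node]
      rw [Nat.cast_sub hM]
      norm_num
  · simp [hw]
  · simp only [hw, Fin.cons_zero]
    rw [max_eq_left (by norm_num), le_div_iff₀ hTpos]
    linarith
  · calc ∑ a, max (-w a) 0 / T * y a ≤ ∑ a, max (-w a) 0 * y a := by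
          refine Finset.sum_le_sum fun a _ => ?_
          have : 0 ≤ y a := by
            refine Fin.cases (by simp [hy]) (fun i => ?_) a
            simpa [hy] using zero_le_one.trans (one_le_node i)
          exact mul_le_mul_of_nonneg_right (div_le_self (le_max_right _ _) hTge) this
      _ ≤ ∑ i ∈ Finset.range (M + 2), |nodeCoeff M i| * node i := by
          rw [Fin.sum_univ_succ]
          simp only [hw, hy, Fin.cons_zero, Fin.cons_succ, mul_zero, zero_add, neg_neg]
          rw [Fin.sum_univ_eq_sum_range (fun i => max (nodeCoeff M i) 0 * node i)]
          refine Finset.sum_le_sum fun i _ => ?_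
          exact mul_le_mul_of_nonneg_right (max_le (le_abs_self _) (abs_nonneg _))
            (zero_le_one.trans (one_le_node i))
      _ ≤ 3 := sum_abs_nodeCoeff_mul_node_le M
  · intro P hP
    have h : ∑ a, (max (w a) 0 / T - max (-w a) 0 / T) * P.eval (y a) =
        (∑ a, w a * P.eval (y a)) / T := by
      rw [Finset.sum_div]
      refine Finset.sum_congr rfl fun a _ => ?_
      rw [← sub_div, hsplit, div_mul_eq_mul_div]
    rw [h, hmom P hP, zero_div]

end Moments

/-! ### Point sets that are locally but not globally clusterable -/

section Geometry

open scoped RealInnerProductSpace Topology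

/-- For small `s > 0`, `‖u - s w‖² = 1 - 2s⟪u, w⟫ + s²‖w‖² < 1`. The strict inequality survives
replacing `u` by `R u` with `R` slightly above `1`. -/
lemma eventually_subset_closedBall {E ι : Type*} [NormedAddCommGroup E] [InnerProductSpace ℝ E]
    {u : ι → E} (hu : ∀ i, ‖u i‖ = 1) {S : Finset ι} {w : E} (hw : ∀ i ∈ S, 0 < ⟪u i, w⟫) :
    ∀ᶠ R : ℝ in 𝓝[>] 1, ∃ c, ∀ i ∈ S, R • u i ∈ Metric.closedBall c 1 := by
  have h1 : ∀ᶠ s : ℝ in 𝓝[>] 0, ∀ i ∈ S, s * ‖w‖ ^ 2 < 2 * ⟪u i, w⟫ := by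
    rw [Filter.eventually_all_finset]
    intro i hi
    have hc : Filter.Tendsto (fun s : ℝ => s * ‖w‖ ^ 2) (𝓝[>] 0) (𝓝 (0 * ‖w‖ ^ 2)) :=
      ((continuous_id.mul continuous_const).tendsto 0).mono_left nhdsWithin_le_nhds
    refine hc.eventually_lt_const ?_
    rw [zero_mul]
    linarith [hw i hi]
  obtain ⟨s, hs, hs0⟩ := (h1.and self_mem_nhdsWithin).exists
  replace hs0 : 0 < s := hs0
  have h2 : ∀ᶠ R : ℝ in 𝓝[>] 1, ∀ i ∈ S, dist (R • u i) (s • w) < 1 := by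
    rw [Filter.eventually_all_finset]
    intro i hi
    have hc : Filter.Tendsto (fun R : ℝ => dist (R • u i) (s • w)) (𝓝[>] 1)
        (𝓝 (dist ((1 : ℝ) • u i) (s • w))) :=
      ((by fun_prop : Continuous fun R : ℝ => dist (R • u i) (s • w)).tendsto 1).mono_left
        nhdsWithin_le_nhds
    refine hc.eventually_lt_const ?_
    rw [one_smul, dist_eq_norm, ← sq_lt_one_iff₀ (norm_nonneg _), norm_sub_sq_real, hu,
      inner_smul_right, norm_smul, Real.norm_of_nonneg hs0.le, mul_pow]
    nlinarith [hs i hi]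
  filter_upwards [h2] with R hR
  exact ⟨s • w, fun i hi => (hR i hi).le⟩

/-- A converse: `R² - 2R⟪u, c⟫ + ‖c‖² ≤ 1 < R²` forces a positive inner product. Points outside the
unit sphere thus share a unit ball only if they lie in an open half-space through the origin. -/
lemma inner_pos_of_mem_closedBall {E : Type*} [NormedAddCommGroup E] [InnerProductSpace ℝ E]
    {u c : E} (hu : ‖u‖ = 1) {R : ℝ} (hR : 1 < R) (h : R • u ∈ Metric.closedBall c 1) :
    0 < ⟪u, c⟫ := by
  rw [Metric.mem_closedBall, dist_eq_norm, ← sq_le_one_iff₀ (norm_nonneg _), norm_sub_sq_real,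
    norm_smul, hu, inner_smul_left, Real.norm_of_nonneg (by linarith)] at h
  simp only [conj_trivial, mul_one] at h
  by_contra! hc
  nlinarith [sq_nonneg ‖c‖]

/-- A polynomial of small degree cannot alternate in sign too often. -/
lemma two_mul_card_le_of_alternating {n N : ℕ} {P : Polynomial ℝ} (hP : P.natDegree < n)
    {S : Finset ℕ} (hSN : S ⊆ Finset.range N) (hS : ∀ i ∈ S, 0 < (-1) ^ i * P.eval (i : ℝ)) :
    2 * S.card ≤ N + n := by
  rcases S.eq_empty_or_nonempty with rfl | ⟨i₀, hi₀⟩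
  · simp
  have hP0 : P ≠ 0 := by
    rintro rfl
    simpa using hS i₀ hi₀
  set S' := S.image (· + 1) with hS'
  have hcard : S'.card = S.card := Finset.card_image_of_injective _ (add_left_injective 1)
  have hunion : (S ∪ S').card ≤ N + 1 := by
    rw [← Finset.card_range (N + 1)]
    refine Finset.card_le_card (Finset.union_subset (hSN.trans ?_) ?_)
    · exact Finset.range_subset_range.2 (Nat.le_succ N)
    · intro j hj
      obtain ⟨i, hi, rfl⟩ := Finset.mem_image.1 hj
      have := Finset.mem_range.1 (hSN hi)
      exact Finset.mem_range.2 (by omega)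
  -- An `i` in both sets has `i - 1` and `i` in `S`, hence a sign change of `P` and a root strictly
  -- between them. These intervals are disjoint, so there are fewer than `n` such `i`.
  have hroot : ∀ i ∈ S ∩ S', ∃ r : ℝ, r ∈ Set.Ioo ((i : ℝ) - 1) i ∧ P.eval r = 0 := by
    intro i hi
    obtain ⟨hi1, hi2⟩ := Finset.mem_inter.1 hi
    obtain ⟨j, hj, rfl⟩ := Finset.mem_image.1 hi2
    have h1 := hS _ hi1
    have h2 := hS _ hj
    have hcont : ContinuousOn (fun t : ℝ => (-1) ^ (j + 1) * P.eval t)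
        (Set.Icc (j : ℝ) ((j + 1 : ℕ) : ℝ)) := by fun_prop
    have := intermediate_value_Ioo (by push_cast; linarith) hcont
    obtain ⟨r, hr, hr0⟩ := this (show (0 : ℝ) ∈ Set.Ioo _ _ from ⟨by
      simp only [pow_succ]; linarith, h1⟩)
    refine ⟨r, by simpa using hr, ?_⟩
    simpa using hr0
  choose! r hr hr0 using hroot
  have hinter : (S ∩ S').card ≤ P.roots.toFinset.card := by
    refine Finset.card_le_card_of_injOn r (fun i hi => ?_) fun i hi j hj hij => ?_
    · simpa [hP0] using hr0 i hi
    · have a1 := hr i hi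
      have a2 := hr j hj
      rw [hij] at a1
      have b1 : (i : ℝ) < j + 1 := by linarith [a1.1, a2.2]
      have b2 : (j : ℝ) < i + 1 := by linarith [a1.2, a2.1]
      have c1 : i < j + 1 := by exact_mod_cast b1
      have c2 : j < i + 1 := by exact_mod_cast b2
      omega
  have h1 := P.roots.toFinset_card_le
  have h2 := P.card_roots'
  have h3 := Finset.card_union_add_card_inter S S'
  omega

/-- The points of the moment curve with alternating signs. -/
noncomputable def alternatingMoment (n i : ℕ) : Space n :=
  WithLp.toLp 2 fun j => (-1) ^ i * (i : ℝ) ^ (j : ℕ)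

lemma alternatingMoment_ne_zero {n : ℕ} (hn : 1 ≤ n) (i : ℕ) : alternatingMoment n i ≠ 0 := by
  intro h
  have := congrArg (fun v : Space n => v ⟨0, hn⟩) h
  simp [alternatingMoment] at this

lemma inner_alternatingMoment {n i : ℕ} (w : Space n) :
    ⟪alternatingMoment n i, w⟫ = (-1) ^ i *
      (∑ j : Fin n, Polynomial.C (w j) * Polynomial.X ^ (j : ℕ) : Polynomial ℝ).eval (i : ℝ) := by
  simp only [alternatingMoment, PiLp.inner_apply, Polynomial.eval_finsetSum, Finset.mul_sum]
  refine Finset.sum_congr rfl fun j _ => ?_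
  simp
  ring

/-- The inner product with `w` is a signed polynomial value, so interpolating the signs at `n` nodes
by a polynomial of degree less than `n` gives `w`. -/
lemma exists_inner_alternatingMoment_eq_one {n N : ℕ} (hn : 1 ≤ n) {S : Finset (Fin N)}
    (hS : S.card ≤ n) : ∃ w : Space n, ∀ i ∈ S, ⟪alternatingMoment n i, w⟫ = 1 := by
  have hinj : Set.InjOn (fun i : Fin N => (i : ℝ)) S :=
    (Nat.cast_injective.comp Fin.val_injective).injOn
  set P := Lagrange.interpolate S (fun i : Fin N => (i : ℝ)) fun i => (-1) ^ (i : ℕ) with hPdef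
  have hdeg : P.natDegree < n := by
    by_cases h0 : P = 0
    · rw [h0, Polynomial.natDegree_zero]; omega
    · rw [Polynomial.natDegree_lt_iff_degree_lt h0]
      refine (Lagrange.degree_interpolate_lt _ hinj).trans_le ?_
      exact_mod_cast hS
  refine ⟨WithLp.toLp 2 fun j => P.coeff j, fun i hi => ?_⟩
  rw [inner_alternatingMoment]
  have h1 : P.eval (i : ℝ) = (-1) ^ (i : ℕ) :=
    Lagrange.eval_interpolate_at_node (s := S) (v := fun i : Fin N => (i : ℝ)) _ hinj hi
  have h2 : (∑ j : Fin n, Polynomial.C (P.coeff j) * Polynomial.X ^ (j : ℕ)) = P := by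
    conv_rhs => rw [P.as_sum_range' n hdeg]
    rw [← Fin.sum_univ_eq_sum_range (fun j => Polynomial.monomial j (P.coeff j))]
    simp [Polynomial.C_mul_X_pow_eq_monomial]
  simp only [h2, h1, ← mul_pow]
  simp

/-- There are `3n` points in `ℝⁿ` such that any `n` of them lie in a unit ball, and each unit ball
contains at most `2n` of them. -/
lemma exists_sphere_points {n : ℕ} (hn : 1 ≤ n) :
    ∃ x : Fin (3 * n) → Space n, (∀ i, ‖x i‖ ≤ 2) ∧
      (∀ S : Finset (Fin (3 * n)), S.card ≤ n → ∃ c, ∀ i ∈ S, x i ∈ Metric.closedBall c 1) ∧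
      ∀ (c : Space n) (S : Finset (Fin (3 * n))), (∀ i ∈ S, x i ∈ Metric.closedBall c 1) →
        S.card ≤ 2 * n := by
  have hv (i : ℕ) : 0 < ‖alternatingMoment n i‖ := norm_pos_iff.2 (alternatingMoment_ne_zero hn i)
  set u : Fin (3 * n) → Space n := fun i =>
    ‖alternatingMoment n i‖⁻¹ • alternatingMoment n i with hu
  have hu1 (i) : ‖u i‖ = 1 := by
    rw [hu, norm_smul, norm_inv, norm_norm, inv_mul_cancel₀ (hv i).ne']
  have hinner (i : Fin (3 * n)) (w : Space n) :
      ⟪u i, w⟫ = ‖alternatingMoment n i‖⁻¹ * ⟪alternatingMoment n i, w⟫ := by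
    rw [hu, inner_smul_left]; rfl
  -- There are finitely many subsets `S`, so one radius `R` serves them all.
  have hev : ∀ᶠ R : ℝ in 𝓝[>] 1, ∀ S : Finset (Fin (3 * n)), S.card ≤ n →
      ∃ c, ∀ i ∈ S, R • u i ∈ Metric.closedBall c 1 := by
    rw [Filter.eventually_all]
    intro S
    by_cases hS : S.card ≤ n
    · obtain ⟨w, hw⟩ := exists_inner_alternatingMoment_eq_one hn hS
      filter_upwards [eventually_subset_closedBall hu1 (S := S) (w := w) fun i hi => by
        rw [hinner, hw i hi, mul_one]; exact inv_pos.2 (hv i)] with R hR _ using hR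
    · exact Filter.Eventually.of_forall fun _ h => absurd h hS
  have hR2 : ∀ᶠ R : ℝ in 𝓝[>] 1, R ∈ Set.Ioo (1 : ℝ) 2 := Ioo_mem_nhdsGT (by norm_num)
  obtain ⟨R, hR, hR1, hR2⟩ := (hev.and hR2).exists
  refine ⟨fun i => R • u i, fun i => ?_, hR, fun c S hS => ?_⟩
  · rw [norm_smul, hu1, mul_one, Real.norm_of_nonneg (by linarith)]
    exact hR2.le
  · have hdeg : (∑ j : Fin n, Polynomial.C (c j) * Polynomial.X ^ (j : ℕ) :
        Polynomial ℝ).natDegree < n := by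
      refine lt_of_le_of_lt (Polynomial.natDegree_sum_le_of_forall_le (n := n - 1) _ _
        fun j _ => ?_) (by omega)
      refine (Polynomial.natDegree_C_mul_X_pow_le _ _).trans ?_
      omega
    have := two_mul_card_le_of_alternating (N := 3 * n) hdeg (S := S.map Fin.valEmbedding)
      (fun i hi => by
        obtain ⟨j, _, rfl⟩ := Finset.mem_map.1 hi
        simp) (fun i hi => by
        obtain ⟨j, hj, rfl⟩ := Finset.mem_map.1 hi
        have h1 := inner_pos_of_mem_closedBall (hu1 j) hR1 (hS j hj)
        rw [hinner, inner_alternatingMoment] at h1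
        exact pos_of_mul_pos_right h1 (inv_nonneg.2 (norm_nonneg _)))
    rw [Finset.card_map] at this
    omega

/-- Greedy covering: while some cluster has more than `n` points left, spend one ball on `n` of
them, which happens at most `S.card / n` times. One ball for each of the `K` clusters finishes. -/
lemma exists_cover {n K : ℕ} (hn : 1 ≤ n) {α : Type*} [DecidableEq α]
    {T : Fin K × α → Space n}
    (hT : ∀ (a : Fin K) (U : Finset (Fin K × α)), (∀ z ∈ U, z.1 = a) → U.card ≤ n →
      ∃ c, ∀ z ∈ U, T z ∈ Metric.closedBall c 1) (S : Finset (Fin K × α)) :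
    ∃ c : ℕ → Space n, ∀ z ∈ S, ∃ l < K + S.card / n, T z ∈ Metric.closedBall (c l) 1 := by
  induction S using Finset.strongInduction with
  | H S ih =>
    by_cases h : ∃ a, n < (S.filter (·.1 = a)).card
    · obtain ⟨a, ha⟩ := h
      obtain ⟨U, hU, hUn⟩ := Finset.exists_subset_card_eq ha.le
      have hUS : U ⊆ S := hU.trans (Finset.filter_subset _ _)
      obtain ⟨c', hc'⟩ := hT a U (fun z hz => (Finset.mem_filter.1 (hU hz)).2) hUn.le
      have hUne : U.Nonempty := Finset.card_pos.1 (by omega)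
      obtain ⟨c, hc⟩ := ih (S \ U) (Finset.sdiff_ssubset hUS hUne)
      rw [Finset.card_sdiff_of_subset hUS, hUn] at hc
      have hle : n ≤ S.card := hUn ▸ Finset.card_le_card hUS
      have hdiv : S.card / n = (S.card - n) / n + 1 := Nat.div_eq_sub_div hn hle
      refine ⟨fun l => if l = K + (S.card - n) / n then c' else c l, fun z hz => ?_⟩
      by_cases hzU : z ∈ U
      · exact ⟨K + (S.card - n) / n, by omega, by simpa using hc' z hzU⟩
      · obtain ⟨l, hl, hl'⟩ := hc z (Finset.mem_sdiff.2 ⟨hz, hzU⟩)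
        exact ⟨l, by omega, by simpa [hl.ne] using hl'⟩
    · push Not at h
      choose c hc using fun a => hT a (S.filter (·.1 = a))
        (fun z hz => (Finset.mem_filter.1 hz).2) (h a)
      refine ⟨fun l => if hl : l < K then c ⟨l, hl⟩ else 0, fun z hz =>
        ⟨z.1, Nat.lt_add_right _ z.1.2, ?_⟩⟩
      simpa using hc z.1 z (Finset.mem_filter.2 ⟨hz, rfl⟩)

/-- A set of `Θ(nk)` points in `ℝⁿ` such that small subsets are `k`-clusterable, while `k` unit
balls always miss a constant fraction of the points. -/
lemma exists_cluster_points {n k : ℕ} (hn : 1 ≤ n) (hk : 1 ≤ k) :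
    ∃ (N : ℕ) (T : Fin N → Space n), 9 * (n * k) ≤ 4 * N ∧ N ≤ 3 * (n * k) ∧
      (∀ S : Finset (Fin N), 4 * S.card ≤ n * k →
        ∃ c : Fin k → Space n, ∀ i ∈ S, ∃ j, T i ∈ Metric.closedBall (c j) 1) ∧
      ∀ (c : Fin k → Space n) (S : Finset (Fin N)),
        (∀ i ∈ S, ∃ j, T i ∈ Metric.closedBall (c j) 1) → S.card ≤ 2 * (n * k) := by
  obtain ⟨x, hx2, hx, hx'⟩ := exists_sphere_points hn
  -- The `k / 4` balls held back pay for the greedy step, and `4K ≥ 3k` still leaves `3nK ≥ 9nk/4 >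
  -- 2nk` points.
  set K := k - k / 4 with hK
  set e : Space n := EuclideanSpace.single ⟨0, hn⟩ (1 : ℝ) with he
  have he1 : ‖e‖ = 1 := by simp [he]
  set T : Fin K × Fin (3 * n) → Space n := fun z => x z.2 + (10 * (z.1 : ℝ)) • e with hTdef
  have hmem (z : Fin K × Fin (3 * n)) (c : Space n) :
      T z ∈ Metric.closedBall c 1 ↔ x z.2 ∈ Metric.closedBall (c - (10 * (z.1 : ℝ)) • e) 1 := by
    simp only [hTdef, Metric.mem_closedBall, dist_eq_norm]
    rw [sub_sub_eq_add_sub]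
  have hsnd (a : Fin K) (U : Finset (Fin K × Fin (3 * n))) (hU : ∀ z ∈ U, z.1 = a) :
      Set.InjOn Prod.snd (U : Set (Fin K × Fin (3 * n))) := fun z hz z' hz' h =>
    Prod.ext ((hU z hz).trans (hU z' hz').symm) h
  have hsmall (a : Fin K) (U : Finset (Fin K × Fin (3 * n))) (hU : ∀ z ∈ U, z.1 = a)
      (hUn : U.card ≤ n) : ∃ c, ∀ z ∈ U, T z ∈ Metric.closedBall c 1 := by
    obtain ⟨c, hc⟩ := hx (U.image Prod.snd) (Finset.card_image_le.trans hUn)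
    refine ⟨c + (10 * (a : ℝ)) • e, fun z hz => ?_⟩
    rw [hmem, hU z hz, add_sub_cancel_right]
    exact hc _ (Finset.mem_image_of_mem _ hz)
  have hball (c : Space n) (U : Finset (Fin K × Fin (3 * n)))
      (hU : ∀ z ∈ U, T z ∈ Metric.closedBall c 1) : U.card ≤ 2 * n := by
    rcases U.eq_empty_or_nonempty with rfl | ⟨z₀, hz₀⟩
    · simp
    have hU1 : ∀ z ∈ U, z.1 = z₀.1 := by
      intro z hz
      by_contra hne
      have h1 : dist (T z) (T z₀) ≤ 2 := by
        have := dist_triangle_right (T z) (T z₀) c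
        have a1 := Metric.mem_closedBall.1 (hU z hz)
        have a2 := Metric.mem_closedBall.1 (hU z₀ hz₀)
        linarith
      -- Two points in a common unit ball are within `2`, and the offsets `x` have norm at most `2`.
      -- Translates of different copies would then be within `6`, but they are at least `10` apart.
      have h2 : (10 * ((z.1 : ℝ) - z₀.1)) • e = (T z - T z₀) - (x z.2 - x z₀.2) := by
        simp only [hTdef, mul_sub, sub_smul]; abel
      have h3 : ‖(10 * ((z.1 : ℝ) - z₀.1)) • e‖ ≤ 6 := by
        rw [h2]
        refine (norm_sub_le _ _).trans ?_
        rw [dist_eq_norm] at h1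
        have := (norm_sub_le (x z.2) (x z₀.2)).trans (add_le_add (hx2 _) (hx2 _))
        linarith
      rw [norm_smul, he1, mul_one, Real.norm_eq_abs, abs_mul] at h3
      have h4 : (1 : ℝ) ≤ |(z.1 : ℝ) - z₀.1| := by
        have : ((z.1 : ℕ) : ℤ) - (z₀.1 : ℕ) ≠ 0 := by
          intro h; exact hne (Fin.ext (by omega))
        exact_mod_cast Int.one_le_abs this
      norm_num at h3
      linarith
    rw [← Finset.card_image_of_injOn (hsnd z₀.1 U hU1)]
    refine hx' (c - (10 * (z₀.1 : ℝ)) • e) _ fun i hi => ?_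
    obtain ⟨z, hz, rfl⟩ := Finset.mem_image.1 hi
    rw [← hU1 z hz, ← hmem]
    exact hU z hz
  have hKk : 3 * k ≤ 4 * K := by omega
  refine ⟨K * (3 * n), T ∘ finProdFinEquiv.symm, by nlinarith, ?_, ?_, ?_⟩
  · have : K ≤ k := Nat.sub_le _ _
    nlinarith
  · intro S hS
    obtain ⟨c, hc⟩ := exists_cover hn hsmall (S.map finProdFinEquiv.symm.toEmbedding)
    rw [Finset.card_map] at hc
    have hle : K + S.card / n ≤ k := by
      have h1 : S.card / n ≤ k / 4 := by
        rw [Nat.le_div_iff_mul_le (by norm_num)]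
        have h2 := Nat.div_mul_le_self S.card n
        refine Nat.le_of_mul_le_mul_left ?_ hn
        nlinarith
      omega
    refine ⟨fun j => c j, fun i hi => ?_⟩
    obtain ⟨l, hl, hl'⟩ := hc (finProdFinEquiv.symm i) (Finset.mem_map.2 ⟨i, hi, rfl⟩)
    exact ⟨⟨l, hl.trans_le hle⟩, hl'⟩
  · intro c S hS
    classical
    have hsub : S ⊆ Finset.univ.biUnion fun j => S.filter fun i =>
        (T ∘ finProdFinEquiv.symm) i ∈ Metric.closedBall (c j) 1 := by
      intro i hi
      obtain ⟨j, hj⟩ := hS i hi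
      exact Finset.mem_biUnion.2 ⟨j, Finset.mem_univ _, Finset.mem_filter.2 ⟨hi, hj⟩⟩
    refine (Finset.card_le_card hsub).trans (Finset.card_biUnion_le.trans ?_)
    calc _ ≤ ∑ _j : Fin k, 2 * n := by
          refine Finset.sum_le_sum fun j _ => ?_
          rw [← Finset.card_map finProdFinEquiv.symm.toEmbedding]
          refine hball (c j) _ fun z hz => ?_
          obtain ⟨i, hi, rfl⟩ := Finset.mem_map.1 hz
          exact (Finset.mem_filter.1 hi).2
      _ = _ := by simp; ring

end Geometry

/-! ### Weighted point distributions and their acceptance probabilities -/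

section Sampling

variable {n N m : ℕ}

/-- The distribution on `Fin N` with probabilities proportional to the weights `w`. -/
noncomputable def indexMeasure (w : Fin N → ℝ) : Measure (Fin N) :=
  ∑ i, ENNReal.ofReal (w i / ∑ j, w j) • Measure.dirac i

/-- The distribution on the points `T i` with probabilities proportional to the weights `w`. -/
noncomputable def pointMeasure (T : Fin N → Space n) (w : Fin N → ℝ) : Measure (Space n) :=
  (indexMeasure w).map T

variable {T : Fin N → Space n} {w : Fin N → ℝ}

lemma indexMeasure_singleton (w : Fin N → ℝ) (i : Fin N) :
    indexMeasure w {i} = ENNReal.ofReal (w i / ∑ j, w j) := by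
  simp [indexMeasure, Measure.finsetSum_apply, Set.indicator_apply]

lemma isProbabilityMeasure_indexMeasure (hw : ∀ i, 0 ≤ w i) (hw0 : 0 < ∑ i, w i) :
    IsProbabilityMeasure (indexMeasure w) := by
  constructor
  simp only [indexMeasure, Measure.finsetSum_apply, Measure.smul_apply, measure_univ, smul_eq_mul,
    mul_one]
  rw [← ENNReal.ofReal_sum_of_nonneg fun i _ => div_nonneg (hw i) hw0.le, ← Finset.sum_div,
    div_self hw0.ne', ENNReal.ofReal_one]

lemma isProbabilityMeasure_pointMeasure (hw : ∀ i, 0 ≤ w i) (hw0 : 0 < ∑ i, w i) :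
    IsProbabilityMeasure (pointMeasure T w) := by
  have := isProbabilityMeasure_indexMeasure hw hw0
  exact Measure.isProbabilityMeasure_map (measurable_of_finite T).aemeasurable

lemma pointMeasure_real_apply (hw : ∀ i, 0 ≤ w i) (hw0 : 0 < ∑ i, w i) {U : Set (Space n)}
    (hU : MeasurableSet U) {F : Finset (Fin N)} (hF : ∀ i, i ∈ F ↔ T i ∈ U) :
    (pointMeasure T w).real U = ∑ i ∈ F, w i / ∑ j, w j := by
  have := isProbabilityMeasure_indexMeasure hw hw0
  have hpre : T ⁻¹' U = F := by ext i; simp [hF]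
  rw [pointMeasure, map_measureReal_apply (measurable_of_finite T) hU, hpre,
    ← sum_measureReal_singleton]
  refine Finset.sum_congr rfl fun i _ => ?_
  rw [measureReal_def, indexMeasure_singleton, ENNReal.toReal_ofReal (div_nonneg (hw i) hw0.le)]

lemma outputProb_pointMeasure (A : SampleAlgorithm n m) [IsMarkovKernel A] (hw : ∀ i, 0 ≤ w i)
    (hw0 : 0 < ∑ i, w i) (b : Bool) :
    outputProb A (pointMeasure T w) b =
      (∑ s : Fin m → Fin N, (A fun t => T (s t)).real {b} * ∏ t, w (s t)) / (∑ i, w i) ^ m := by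
  have := isProbabilityMeasure_indexMeasure hw hw0
  have hT : Measurable T := measurable_of_finite T
  have hpi : (Measure.pi fun _ : Fin m => pointMeasure T w) =
      (Measure.pi fun _ : Fin m => indexMeasure w).map fun s t => T (s t) :=
    (Measure.pi_map_pi fun _ => hT.aemeasurable).symm
  have hmeas : Measurable fun (s : Fin m → Fin N) t => T (s t) := measurable_of_finite _
  rw [outputProb, measureReal_def, hpi, Measure.bind_apply (measurableSet_singleton b)
    A.aemeasurable, lintegral_map (A.measurable_coe (measurableSet_singleton b)) hmeas,
    lintegral_fintype, ENNReal.toReal_sum fun s _ => by finiteness, Finset.sum_div]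
  refine Finset.sum_congr rfl fun s _ => ?_
  rw [Measure.pi_singleton, ENNReal.toReal_mul, ENNReal.toReal_prod, mul_div_assoc]
  congr 1
  simp only [indexMeasure_singleton, ENNReal.toReal_ofReal (div_nonneg (hw _) hw0.le)]
  rw [Finset.prod_div_distrib, Finset.prod_const, Finset.card_univ, Fintype.card_fin]

lemma isProbabilityMeasure_bind {A : SampleAlgorithm n m} [IsMarkovKernel A]
    {D : Measure (Space n)} [IsProbabilityMeasure D] :
    IsProbabilityMeasure ((Measure.pi fun _ : Fin m => D).bind A) :=
  ⟨by rw [Measure.bind_apply MeasurableSet.univ A.aemeasurable]; simp only [measure_univ, lintegral_one]⟩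

lemma outputProb_nonneg (A : SampleAlgorithm n m) (D : Measure (Space n)) (b : Bool) :
    0 ≤ outputProb A D b :=
  measureReal_nonneg

lemma outputProb_true_add_false (A : SampleAlgorithm n m) [IsMarkovKernel A]
    (D : Measure (Space n)) [IsProbabilityMeasure D] :
    outputProb A D true + outputProb A D false = 1 := by
  have := isProbabilityMeasure_bind (A := A) (D := D)
  have hc : ({false} : Set Bool) = {true}ᶜ := by ext b; cases b <;> simp
  rw [outputProb, outputProb, hc]
  exact probReal_add_probReal_compl (measurableSet_singleton true)

lemma isClusterable_pointMeasure (hw : ∀ i, 0 ≤ w i) (hw0 : 0 < ∑ i, w i) {k : ℕ}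
    {c : Fin k → Space n} (hc : ∀ i, w i ≠ 0 → ∃ j, T i ∈ Metric.closedBall (c j) 1) :
    IsClusterable k (pointMeasure T w) := by
  have := isProbabilityMeasure_pointMeasure (T := T) hw hw0
  have hU : IsClosed (⋃ j, Metric.closedBall (c j) 1) :=
    isClosed_iUnion_of_finite fun _ => Metric.isClosed_closedBall
  refine ⟨c, Measure.support_subset_of_isClosed hU ?_⟩
  classical
  rw [mem_ae_iff, ← measureReal_eq_zero_iff, pointMeasure_real_apply hw hw0 hU.measurableSet.compl
    (F := Finset.univ.filter fun i => T i ∉ ⋃ j, Metric.closedBall (c j) 1) (by simp)]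
  refine Finset.sum_eq_zero fun i hi => ?_
  by_cases h : w i = 0
  · simp [h]
  · exact absurd (Set.mem_iUnion.2 (hc i h)) (Finset.mem_filter.1 hi).2

lemma abs_real_sub_real_le_tvDist {α : Type*} [MeasurableSpace α] (μ ν : Measure α)
    [IsProbabilityMeasure μ] [IsProbabilityMeasure ν] {S : Set α} (hS : MeasurableSet S) :
    |μ.real S - ν.real S| ≤ tvDist μ ν := by
  refine le_ciSup (f := fun S : {S : Set α // MeasurableSet S} => |μ.real S.1 - ν.real S.1|)
    ⟨1, ?_⟩ ⟨S, hS⟩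
  rintro _ ⟨S, rfl⟩
  have h1 := measureReal_nonneg (μ := μ) (s := S.1)
  have h2 := measureReal_nonneg (μ := ν) (s := S.1)
  have h3 := measureReal_le_one (μ := μ) (s := S.1)
  have h4 := measureReal_le_one (μ := ν) (s := S.1)
  exact abs_le.2 ⟨by linarith, by linarith⟩

/-- The test set is the complement of the `k` balls: `D'` gives it mass `0`, while it contains at
least `N - B` points of weight at least `1`. -/
lemma isFarFromClusterable_pointMeasure {k B : ℕ} {ε : ℝ} (hw : ∀ i, 1 ≤ w i)
    (hw0 : 0 < ∑ i, w i)
    (hB : ∀ (c : Fin k → Space n) (S : Finset (Fin N)),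
      (∀ i ∈ S, ∃ j, T i ∈ Metric.closedBall (c j) 1) → S.card ≤ B)
    (hε : ε * ∑ i, w i ≤ N - B) :
    IsFarFromClusterable k ε (pointMeasure T w) := by
  rintro D' hD' ⟨c, hc⟩
  have hwn : ∀ i, 0 ≤ w i := fun i => zero_le_one.trans (hw i)
  have := isProbabilityMeasure_pointMeasure (T := T) hwn hw0
  set U := ⋃ j, Metric.closedBall (c j) 1 with hUdef
  have hU : IsClosed U := isClosed_iUnion_of_finite fun _ => Metric.isClosed_closedBall
  have hD'U : D'.real Uᶜ = 0 := by
    rw [measureReal_eq_zero_iff]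
    exact measure_mono_null (Set.compl_subset_compl.2 hc) Measure.measure_compl_support
  classical
  have h1 := pointMeasure_real_apply (T := T) hwn hw0 hU.measurableSet.compl
    (F := (Finset.univ.filter fun i => T i ∈ U)ᶜ) (by simp)
  have hcard : (Finset.univ.filter fun i => T i ∈ U).card ≤ B :=
    hB c _ fun i hi => Set.mem_iUnion.1 (Finset.mem_filter.1 hi).2
  have h2 : ε ≤ (pointMeasure T w).real Uᶜ := by
    rw [h1, ← Finset.sum_div, le_div_iff₀ hw0]
    refine hε.trans ?_
    have h3 : ((Finset.univ.filter fun i => T i ∈ U)ᶜ.card : ℝ) ≤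
        ∑ i ∈ (Finset.univ.filter fun i => T i ∈ U)ᶜ, w i := by
      have := Finset.card_nsmul_le_sum (Finset.univ.filter fun i => T i ∈ U)ᶜ w 1 fun i _ => hw i
      simpa using this
    refine le_trans ?_ h3
    rw [Finset.card_compl, Fintype.card_fin, Nat.cast_sub
      ((Finset.card_le_univ _).trans_eq (Fintype.card_fin N))]
    have : ((Finset.univ.filter fun i => T i ∈ U).card : ℝ) ≤ B := by exact_mod_cast hcard
    linarith
  have h4 := abs_real_sub_real_le_tvDist (pointMeasure T w) D' hU.measurableSet.compl
  rw [hD'U, sub_zero] at h4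
  exact h2.trans ((le_abs_self _).trans h4)

end Sampling

/-! ### Matching moments fool the tester -/

section Indistinguishability

variable {n N m : ℕ}

open Polynomial in
lemma coeff_prod_nonneg {ι : Type*} (s : Finset ι) (f : ι → ℝ[X])
    (h : ∀ i ∈ s, ∀ j, 0 ≤ (f i).coeff j) (j : ℕ) : 0 ≤ (∏ i ∈ s, f i).coeff j := by
  revert j
  refine Finset.prod_induction f (fun P => ∀ j, 0 ≤ P.coeff j) (fun P Q hP hQ j => ?_)
    (fun j => ?_) h
  · rw [coeff_mul]
    exact Finset.sum_nonneg fun x _ => mul_nonneg (hP _) (hQ _)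
  · rw [coeff_one]
    split_ifs <;> norm_num

lemma one_add_div_one_sub_le_exp {z : ℝ} (hz : 0 ≤ z) (hz1 : z ≤ 1 / 2) :
    (1 + z) / (1 - z) ≤ Real.exp (4 * z) := by
  have h := Real.add_one_le_exp (4 * z)
  rw [div_le_iff₀ (by linarith)]
  nlinarith

/-- As a function of a single weight, the probability of an output is close to a polynomial. -/
lemma exists_polynomial_approx_outputProb (T : Fin N → Space n) (A : SampleAlgorithm n m)
    [IsMarkovKernel A] (b : Bool) (i : Fin N) {u : Fin N → ℝ} (hu : ∀ j, 0 ≤ u j) {K : ℝ}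
    (hK : 0 < K) (hKu : K ≤ ∑ j, u j) (L : ℕ) {r lam : ℝ} (hr : 0 < r) (hr1 : r ≤ 1)
    (hlam0 : 0 ≤ lam) (hlam : lam / (r * K) ≤ 1 / 2) :
    ∃ P : Polynomial ℝ, P.natDegree ≤ L ∧ ∀ v, 0 ≤ v → v ≤ lam →
      |outputProb A (pointMeasure T fun j => u j + if j = i then v else 0) b - P.eval v| ≤
        r ^ (L + 1) * Real.exp (4 * m * (lam / (r * K))) := by
  classical
  set S := ∑ j, u j with hS
  have hS0 : 0 < S := hK.trans_le hKu
  set Q : Polynomial ℝ := ∑ s : Fin m → Fin N, Polynomial.C ((A fun t => T (s t)).real {b}) *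
    ∏ t, (Polynomial.C (u (s t)) + if s t = i then Polynomial.X else 0) with hQ
  have hQeval (x : ℝ) : Q.eval x = ∑ s : Fin m → Fin N, (A fun t => T (s t)).real {b} *
      ∏ t, (u (s t) + if s t = i then x else 0) := by
    simp only [hQ, Polynomial.eval_finsetSum, Polynomial.eval_mul, Polynomial.eval_C,
      Polynomial.eval_prod, Polynomial.eval_add, apply_ite (Polynomial.eval x), Polynomial.eval_X,
      Polynomial.eval_zero]
  have hsum (x : ℝ) : ∑ j, (u j + if j = i then x else 0) = S + x := by
    simp [Finset.sum_add_distrib, hS]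
  have hnn (x : ℝ) (hx : 0 ≤ x) (j : Fin N) : 0 ≤ u j + if j = i then x else 0 := by
    have := hu j
    split_ifs <;> linarith
  have hzS : lam / (r * S) ≤ lam / (r * K) := by gcongr
  have hzS0 : 0 ≤ lam / (r * S) := by positivity
  have hcoeff (j : ℕ) : 0 ≤ Q.coeff j := by
    rw [hQ, Polynomial.finsetSum_coeff]
    refine Finset.sum_nonneg fun s _ => ?_
    rw [Polynomial.coeff_C_mul]
    refine mul_nonneg measureReal_nonneg (coeff_prod_nonneg _ _ (fun t _ l => ?_) j)
    rw [Polynomial.coeff_add, Polynomial.coeff_C]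
    refine add_nonneg ?_ ?_
    · split_ifs
      exacts [hu _, le_rfl]
    · split_ifs
      · rw [Polynomial.coeff_X]; split_ifs <;> norm_num
      · simp
  have hdom (x : ℝ) (hx : 0 ≤ x) : Q.eval x ≤ (S + x) ^ m := by
    rw [hQeval, ← hsum x, Fintype.sum_pow]
    refine Finset.sum_le_sum fun s _ => ?_
    exact mul_le_of_le_one_left (Finset.prod_nonneg fun t _ => hnn x hx _) measureReal_le_one
  have hlt : lam < r * S := by
    have : lam / (r * S) < 1 := by linarith
    rwa [div_lt_one (by positivity)] at this
  obtain ⟨P, hP, hPQ⟩ := exists_polynomial_approx hcoeff hS0 L hdom hr hr1 hlt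
  refine ⟨P, hP, fun v hv hvl => ?_⟩
  have h := hPQ v hv hvl
  rw [hQeval, ← hsum v] at h
  rw [outputProb_pointMeasure A (hnn v hv) (by rw [hsum]; linarith)]
  refine h.trans ?_
  have h1 : ((1 + lam / (r * S)) / (1 - lam / (r * S))) ^ m ≤
      Real.exp (4 * m * (lam / (r * K))) := by
    calc _ ≤ Real.exp (4 * (lam / (r * S))) ^ m := by
          refine pow_le_pow_left₀ (div_nonneg (by linarith) (by linarith)) ?_ m
          exact one_add_div_one_sub_le_exp hzS0 (hzS.trans hlam)
      _ = Real.exp (m * (4 * (lam / (r * S)))) := (Real.exp_nat_mul _ _).symm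
      _ ≤ _ := by
          rw [Real.exp_le_exp, mul_left_comm, ← mul_assoc]
          gcongr
  gcongr

/-- Random weights with matching moments cannot be told apart with few samples. -/
lemma abs_prodMean_outputProb_sub_le (T : Fin N → Space n) (A : SampleAlgorithm n m)
    [IsMarkovKernel A] (b : Bool) {κ : Type*} [Fintype κ] {y p q : κ → ℝ} (hp : ∀ a, 0 ≤ p a)
    (hq : ∀ a, 0 ≤ q a) (hp1 : ∑ a, p a = 1) (hq1 : ∑ a, q a = 1) {L : ℕ}
    (hmom : ∀ P : Polynomial ℝ, P.natDegree ≤ L → ∑ a, (p a - q a) * P.eval (y a) = 0)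
    {r lam : ℝ} (hr : 0 < r) (hr1 : r ≤ 1) (hy : ∀ a, 0 ≤ y a) (hylam : ∀ a, y a ≤ lam)
    {g : Fin N → ℝ} (hg : ∀ j, 0 ≤ g j) (hg0 : 0 < ∑ j, g j) (hlam0 : 0 ≤ lam)
    (hlam : lam / (r * ∑ j, g j) ≤ 1 / 2) :
    |prodMean p (fun σ => outputProb A (pointMeasure T fun j => y (σ j) + g j) b) -
      prodMean q (fun σ => outputProb A (pointMeasure T fun j => y (σ j) + g j) b)| ≤
      N * (2 * (r ^ (L + 1) * Real.exp (4 * m * (lam / (r * ∑ j, g j))))) := by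
  refine abs_prodMean_sub_prodMean_le hp hq hp1 hq1 _ fun i σ => ?_
  set e := r ^ (L + 1) * Real.exp (4 * m * (lam / (r * ∑ j, g j)))
  set u : Fin N → ℝ := fun j => (if j = i then 0 else y (σ j)) + g j with hudef
  have hu (j) : 0 ≤ u j := add_nonneg (by split_ifs; exacts [le_rfl, hy _]) (hg j)
  obtain ⟨P, hP, hPu⟩ := exists_polynomial_approx_outputProb T A b i hu hg0
    (Finset.sum_le_sum fun j _ => le_add_of_nonneg_left (by split_ifs; exacts [le_rfl, hy _]))
    L hr hr1 hlam0 hlam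
  have hupd (a : κ) : (fun j => y (Function.update σ i a j) + g j) =
      fun j => u j + if j = i then y a else 0 := by
    funext j
    by_cases h : j = i
    · subst h; simp [hudef, add_comm]
    · simp [hudef, h]
  simp only [hupd]
  -- By moment matching, the approximating polynomial may be subtracted at no cost.
  have hsub : ∑ a, (p a - q a) *
      outputProb A (pointMeasure T fun j => u j + if j = i then y a else 0) b =
      ∑ a, (p a - q a) *
        (outputProb A (pointMeasure T fun j => u j + if j = i then y a else 0) b -
          P.eval (y a)) := by
    simp only [mul_sub, Finset.sum_sub_distrib]
    rw [hmom P hP, sub_zero]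
  rw [hsub]
  refine (Finset.abs_sum_le_sum_abs _ _).trans ?_
  calc _ ≤ ∑ a, (p a + q a) * e := by
        refine Finset.sum_le_sum fun a _ => ?_
        rw [abs_mul]
        refine mul_le_mul ?_ (hPu _ (hy a) (hylam a)) (abs_nonneg _) (add_nonneg (hp a) (hq a))
        exact abs_le.2 ⟨by linarith [hp a], by linarith [hq a]⟩
    _ = 2 * e := by rw [← Finset.sum_mul, Finset.sum_add_distrib, hp1, hq1]; ring

end Indistinguishability

/-! ### The lower bound for a fixed number of moments -/

section LowerBound

variable {n k m : ℕ} {ε : ℝ} {A : SampleAlgorithm n m}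

lemma IsTester.outputProb_true_le (hA : IsTester n k ε A) {D : Measure (Space n)}
    [IsProbabilityMeasure D] (hD : IsFarFromClusterable k ε D) : outputProb A D true ≤ 1 / 3 := by
  have := hA.isMarkovKernel
  have h1 := outputProb_true_add_false A D
  have h2 := hA.rejects D inferInstance hD
  linarith

/-- A tester needs at least one sample. -/
lemma IsTester.ne_zero (hA : IsTester n k ε A) (hn : 1 ≤ n) (hk : 1 ≤ k) (hε : 0 < ε)
    (hε1 : ε ≤ 1 / 549) : m ≠ 0 := by
  rintro rfl
  obtain ⟨N, T, hN, -, -, hT⟩ := exists_cluster_points hn hk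
  have hX : 1 ≤ n * k := Nat.mul_pos hn hk
  have hN' : (9 * (n * k) : ℝ) ≤ 4 * N := by exact_mod_cast hN
  have hX' : (1 : ℝ) ≤ n * k := by exact_mod_cast hX
  have hsum : ∑ _i : Fin N, (1 : ℝ) = N := by simp
  have hsum0 : 0 < ∑ _i : Fin N, (1 : ℝ) := by rw [hsum]; linarith
  have hfar : IsFarFromClusterable k ε (pointMeasure T fun _ => 1) := by
    refine isFarFromClusterable_pointMeasure (fun _ => le_rfl) hsum0 hT ?_
    rw [hsum]
    push_cast
    nlinarith
  have := isProbabilityMeasure_pointMeasure (T := T) (fun _ => zero_le_one) hsum0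
  have h1 := hA.outputProb_true_le hfar
  have hcl : IsClusterable k (Measure.dirac (0 : Space n)) := by
    refine ⟨fun _ => 0, ?_⟩
    refine (Measure.support_subset_of_isClosed (t := Metric.closedBall 0 1)
      Metric.isClosed_closedBall ?_).trans
        (Set.subset_iUnion (fun _ : Fin k => Metric.closedBall (0 : Space n) 1) ⟨0, hk⟩)
    rw [mem_ae_iff, Measure.dirac_apply' _ measurableSet_closedBall.compl]
    simp
  have h2 := hA.accepts _ inferInstance hcl
  have h3 : outputProb A (Measure.dirac 0) true = outputProb A (pointMeasure T fun _ => 1) true := by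
    -- With no samples both product measures are the same point mass.
    unfold outputProb
    congr 4
    exact Subsingleton.elim _ _
  linarith

/-- The main estimate: `M` is the number of matched moments. -/
lemma IsTester.contradiction (hA : IsTester n k ε A) (hX8 : 8 ≤ n * k) (hε : 0 < ε)
    (hε1 : ε ≤ 1 / 549) {M : ℕ} (hM : 1 ≤ M) (hXM : ((n : ℝ) * k) ≤ Real.exp M)
    (hz : 10 ^ 6 * (M : ℝ) ^ 2 / (Real.exp (-3) * (n * k)) ≤ 1 / 2)
    (hmz : 4 * m * (10 ^ 6 * (M : ℝ) ^ 2 / (Real.exp (-3) * (n * k))) ≤ M) : False := by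
  have hn : 1 ≤ n := Nat.pos_of_mul_pos_right (by omega : 0 < n * k)
  have hk : 1 ≤ k := Nat.pos_of_mul_pos_left (by omega : 0 < n * k)
  have := hA.isMarkovKernel
  obtain ⟨N, T, hN, hN3, hyes, hno⟩ := exists_cluster_points hn hk
  obtain ⟨y, p, q, hp, hq, hp1, hq1, hy0, hy1, hylam, hq0, hp0, hqy, hmom⟩ :=
    exists_moment_matching hM
  set X : ℝ := (n : ℝ) * k with hXdef
  have hX8' : (8 : ℝ) ≤ X := by rw [hXdef]; exact_mod_cast hX8
  have hN' : 9 * X ≤ 4 * N := by rw [hXdef]; exact_mod_cast hN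
  have hN3' : (N : ℝ) ≤ 3 * X := by rw [hXdef]; exact_mod_cast hN3
  have hNpos : 0 < N := by omega
  have hNR : (0 : ℝ) < N := by exact_mod_cast hNpos
  set i₀ : Fin N := ⟨0, hNpos⟩
  -- The deterministic weight `N` on a single point bounds the total weight below under both laws,
  -- and it adds only one point to the support.
  set g : Fin N → ℝ := fun i => if i = i₀ then (N : ℝ) else 0 with hgdef
  have hg (i) : 0 ≤ g i := by rw [hgdef]; dsimp only; split_ifs <;> positivity
  have hgsum : ∑ i, g i = N := by simp [hgdef]
  have hy (a) : 0 ≤ y a := by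
    by_cases h : a = 0
    · rw [h, hy0]
    · exact zero_le_one.trans (hy1 a h)
  set lam : ℝ := 10 ^ 6 * (M : ℝ) ^ 2
  have hlam0 : 0 ≤ lam := by positivity
  have hzle : lam / (Real.exp (-3) * ∑ i, g i) ≤ lam / (Real.exp (-3) * X) := by
    rw [hgsum]
    gcongr
    linarith
  set W : (Fin N → Fin (M + 3)) → Fin N → ℝ := fun σ i => y (σ i) + g i with hW
  have hWn (σ i) : 0 ≤ W σ i := add_nonneg (hy _) (hg i)
  have hWsum (σ) : ∑ i, W σ i = ∑ i, y (σ i) + N := by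
    rw [hW]; simp only [Finset.sum_add_distrib, hgsum]
  have hWpos (σ) : 0 < ∑ i, W σ i := by
    rw [hWsum]
    have : 0 ≤ ∑ i, y (σ i) := Finset.sum_nonneg fun i _ => hy _
    linarith
  have hprob (σ) : IsProbabilityMeasure (pointMeasure T (W σ)) :=
    isProbabilityMeasure_pointMeasure (hWn σ) (hWpos σ)
  set G : (Fin N → Fin (M + 3)) → ℝ := fun σ => outputProb A (pointMeasure T (W σ)) true with hG
  have hG0 (σ) : 0 ≤ G σ := outputProb_nonneg _ _ _
  have hG1 (σ) : G σ ≤ 1 := by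
    have h1 := outputProb_true_add_false A (pointMeasure T (W σ))
    have h2 := outputProb_nonneg A (pointMeasure T (W σ)) false
    simp only [hG]
    linarith
  have hp_bound : 19 / 30 ≤ prodMean p G := by
    have hpt (σ) : 2 / 3 - 2 / 3 * (8 / X) * ∑ i, (if σ i = 0 then (0 : ℝ) else 1) ≤ G σ := by
      have hcount : ∑ i, (if σ i = 0 then (0 : ℝ) else 1) =
          ((Finset.univ.filter fun i => σ i ≠ 0).card : ℝ) := by
        rw [Finset.card_filter]
        push_cast
        exact Finset.sum_congr rfl fun i _ => by by_cases h : σ i = 0 <;> simp [h]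
      rw [hcount]
      set F := Finset.univ.filter fun i => σ i ≠ 0
      by_cases hF : 4 * (F.card + 1) ≤ n * k
      · obtain ⟨c, hc⟩ := hyes (insert i₀ F)
          ((Nat.mul_le_mul_left 4 (Finset.card_insert_le _ _)).trans hF)
        have hcl : IsClusterable k (pointMeasure T (W σ)) := by
          refine isClusterable_pointMeasure (hWn σ) (hWpos σ) (c := c) fun i hi => hc i ?_
          by_contra hni
          rw [Finset.mem_insert, not_or, Finset.mem_filter] at hni
          have h0 : σ i = 0 := by simpa using hni.2
          exact hi (by simp [hW, hgdef, h0, hy0, hni.1])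
        have h1 := hA.accepts _ inferInstance hcl
        have h2 : 0 ≤ 2 / 3 * (8 / X) * (F.card : ℝ) := by positivity
        simp only [hG]
        linarith
      -- Here `F.card > X/4 - 1 ≥ X/8` because `X ≥ 8`, so the lower bound for `G σ` is at most `0`.
      · have h1 : X < 4 * ((F.card : ℝ) + 1) := by
          rw [hXdef]; exact_mod_cast not_le.1 hF
        have h2 : 1 ≤ 8 / X * (F.card : ℝ) := by
          rw [div_mul_eq_mul_div, le_div_iff₀ (by linarith)]
          linarith
        refine le_trans ?_ (hG0 σ)
        linarith
    have h1 := prodMean_mono hp hpt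
    rw [prodMean_sub, prodMean_const hp1, prodMean_const_mul,
      prodMean_sum hp1 fun a => if a = 0 then (0 : ℝ) else 1] at h1
    have h2 : ∑ a, p a * (if a = 0 then (0 : ℝ) else 1) = 1 - p 0 := by
      have h := hp1
      rw [Fin.sum_univ_succ] at h ⊢
      simp only [if_true, Fin.succ_ne_zero, if_false, mul_zero, mul_one, zero_add]
      linarith
    rw [h2] at h1
    have h3 : (N : ℝ) * (1 - p 0) ≤ 3 * X * (1 / 480) := by
      refine mul_le_mul hN3' (by linarith) ?_ (by linarith)
      have := Finset.single_le_sum (fun a _ => hp a) (Finset.mem_univ (0 : Fin (M + 3)))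
      linarith
    have h4 : 2 / 3 * (8 / X) * (N * (1 - p 0)) ≤ 2 / 3 * (8 / X) * (3 * X * (1 / 480)) := by
      gcongr
    have h5 : 2 / 3 * (8 / X) * (3 * X * (1 / 480)) = 1 / 30 := by
      field_simp; norm_num
    linarith
  have hq_bound : prodMean q G ≤ 23 / 60 := by
    -- Markov's inequality in pointwise form: the last two terms dominate the indicators of a zero
    -- weight, which has `q`-mass `0`, and of a total above `60 N`, which costs at most `3/60`.
    have hpt (σ) : G σ ≤ 1 / 3 + (∑ i, (if σ i = 0 then (1 : ℝ) else 0) +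
        1 / (60 * N) * ∑ i, y (σ i)) := by
      have hn1 : 0 ≤ ∑ i, (if σ i = 0 then (1 : ℝ) else 0) :=
        Finset.sum_nonneg fun i _ => by split_ifs <;> norm_num
      have hn2 : 0 ≤ 1 / (60 * N) * ∑ i, y (σ i) :=
        mul_nonneg (by positivity) (Finset.sum_nonneg fun i _ => hy _)
      by_cases h0 : ∃ i, σ i = 0
      · obtain ⟨i, hi⟩ := h0
        have : 1 ≤ ∑ i, (if σ i = 0 then (1 : ℝ) else 0) := by
          have := Finset.single_le_sum (f := fun i => if σ i = 0 then (1 : ℝ) else 0)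
            (fun i _ => by split_ifs <;> norm_num) (Finset.mem_univ i)
          simpa [hi] using this
        linarith [hG1 σ]
      by_cases hs : ∑ i, y (σ i) ≤ 60 * N
      · push Not at h0
        have hfar : IsFarFromClusterable k ε (pointMeasure T (W σ)) := by
          refine isFarFromClusterable_pointMeasure
            (fun i => (hy1 _ (h0 i)).trans (le_add_of_nonneg_right (hg i))) (hWpos σ) hno ?_
          -- The constant is `549 = 9 * 61`: the product is `N/9`, and `N - 2X ≥ N/9` because `4N ≥
          -- 9X`.
          calc ε * ∑ i, W σ i ≤ 1 / 549 * (61 * N) := by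
                refine mul_le_mul hε1 ?_ (hWpos σ).le (by norm_num)
                rw [hWsum]; linarith
            _ ≤ _ := by push_cast; rw [← hXdef]; linarith
        have := hA.outputProb_true_le hfar
        simp only [hG]
        linarith
      · have : 1 ≤ 1 / (60 * N) * ∑ i, y (σ i) := by
          rw [one_div_mul_eq_div, le_div_iff₀ (by positivity)]
          linarith
        linarith [hG1 σ]
    have h1 := prodMean_mono hq hpt
    rw [prodMean_add, prodMean_const hq1, prodMean_add, prodMean_const_mul,
      prodMean_sum hq1 fun a => if a = 0 then (1 : ℝ) else 0, prodMean_sum hq1 y] at h1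
    have h2 : ∑ a, q a * (if a = 0 then (1 : ℝ) else 0) = 0 := by simp [hq0]
    have h3 : 1 / (60 * (N : ℝ)) * (N * ∑ a, q a * y a) ≤ 1 / (60 * N) * (N * 3) := by gcongr
    have h4 : 1 / (60 * (N : ℝ)) * (N * 3) = 1 / 20 := by field_simp; norm_num
    rw [h2] at h1
    linarith
  have hdiff := abs_prodMean_outputProb_sub_le T A true hp hq hp1 hq1 hmom (Real.exp_pos (-3))
    (Real.exp_le_one_iff.2 (by norm_num)) hy hylam hg (by rw [hgsum]; exact hNR) hlam0
    (hzle.trans hz)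
  have hdiff' := (le_abs_self _).trans hdiff
  have hexp : Real.exp (4 * m * (lam / (Real.exp (-3) * ∑ j, g j))) ≤ Real.exp M := by
    rw [Real.exp_le_exp]
    refine le_trans ?_ hmz
    gcongr
  -- Since `N ≤ 3X ≤ 3E`, one factor `E⁻¹` absorbs `N`, a second absorbs the exponential, and the
  -- third remains. The result is below the gap `19/30 - 23/60 = 1/4`.
  have hfinal : (N : ℝ) * (2 * (Real.exp (-3) ^ (M + 1) *
      Real.exp (4 * m * (lam / (Real.exp (-3) * ∑ j, g j))))) ≤ 6 / 8 * Real.exp (-3) := by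
    set E := Real.exp M with hE
    have hE0 : 0 < E := Real.exp_pos _
    have hpow : Real.exp (-3) ^ (M + 1) = Real.exp (-3) * (E ^ 3)⁻¹ := by
      rw [pow_succ', ← Real.exp_nat_mul (-3) M, hE, ← Real.exp_nat_mul, ← Real.exp_neg]
      congr 2
      push_cast
      ring
    have h8 : 8 ≤ E := hX8'.trans hXM
    calc _ ≤ (3 * E) * (2 * (Real.exp (-3) * (E ^ 3)⁻¹ * E)) := by
          rw [hpow]
          gcongr
          exact hN3'.trans (by linarith)
      _ = 6 / E * Real.exp (-3) := by field_simp; norm_num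
      _ ≤ _ := by gcongr
  have he3 : Real.exp (-3) ≤ 1 / 4 := by
    rw [Real.exp_neg, ← one_div]
    exact one_div_le_one_div_of_le (by norm_num) (by linarith [Real.add_one_le_exp (3 : ℝ)])
  have h1 : prodMean p G - prodMean q G ≤ 6 / 8 * Real.exp (-3) := hdiff'.trans hfinal
  linarith

end LowerBound

end Clusterability

/-! ### Choice of constants -/

theorem mainTheorem8 :
    ∃ ε₀ : ℝ, 0 < ε₀ ∧ ∃ c : ℝ, 0 < c ∧
      ∀ ε : ℝ, 0 < ε → ε ≤ ε₀ →
        ∀ n k : ℕ, 2 ≤ n * k →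
          ∀ (m : ℕ) (A : Clusterability.SampleAlgorithm n m),
            Clusterability.IsTester n k ε A →
              c * (((n : ℝ) * k) / Real.log ((n : ℝ) * k)) ≤ m := by
  set e : ℝ := Real.exp (-3) with he
  have he0 : 0 < e := Real.exp_pos _
  -- With `M ≤ 2 log X`, the constant `e / (8 * 10⁶)` is what both `10⁶ M² ≤ e X / 2` and `4 m * 10⁶
  -- M² ≤ e X M` require.
  obtain ⟨X₀, hX₀⟩ := Filter.eventually_atTop.1
    ((Real.isLittleO_pow_log_id_atTop (n := 2)).bound (by positivity : 0 < e / (8 * 10 ^ 6)))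
  set X₁ : ℝ := max X₀ 8 with hX₁
  have hX₁8 : 8 ≤ X₁ := le_max_right _ _
  have hlog2 : 0 < Real.log 2 := Real.log_pos (by norm_num)
  refine ⟨1 / 549, by norm_num, min (e / (8 * 10 ^ 6)) (Real.log 2 / X₁),
    lt_min (by positivity) (by positivity), fun ε hε hε1 n k hnk m A hA => ?_⟩
  have hn : 1 ≤ n := Nat.pos_of_mul_pos_right (by omega : 0 < n * k)
  have hk : 1 ≤ k := Nat.pos_of_mul_pos_left (by omega : 0 < n * k)
  have hm : (1 : ℝ) ≤ m := by exact_mod_cast Nat.one_le_iff_ne_zero.2 (hA.ne_zero hn hk hε hε1)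
  set X : ℝ := (n : ℝ) * k with hX
  have hX2 : 2 ≤ X := by rw [hX]; exact_mod_cast hnk
  have hlogX : Real.log 2 ≤ Real.log X := Real.log_le_log (by norm_num) hX2
  have hlogX0 : 0 < Real.log X := hlog2.trans_le hlogX
  by_contra! hlt
  rcases lt_or_ge X X₁ with hXX | hXX
  -- For bounded `X` the claimed bound is at most `1`, and a tester uses at least one sample.
  · have : Real.log 2 / X₁ * (X / Real.log X) ≤ 1 := by
      rw [div_mul_div_comm, div_le_one (by positivity), mul_comm]
      exact mul_le_mul hXX.le hlogX hlog2.le (by positivity)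
    have h2 : min (e / (8 * 10 ^ 6)) (Real.log 2 / X₁) * (X / Real.log X) ≤
        Real.log 2 / X₁ * (X / Real.log X) := by
      gcongr
      exact min_le_right _ _
    linarith
  · have hX8 : 8 ≤ X := hX₁8.trans hXX
    have hlog1 : 1 ≤ Real.log X := by
      rw [Real.le_log_iff_exp_le (by linarith)]
      linarith [Real.exp_one_lt_d9]
    have hsq : Real.log X ^ 2 ≤ e / (8 * 10 ^ 6) * X := by
      have := hX₀ X ((le_max_left _ _).trans hXX)
      rwa [Real.norm_of_nonneg (by positivity), id, Real.norm_of_nonneg (by linarith)] at this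
    set M := ⌈Real.log X⌉₊ with hMdef
    have hMge : Real.log X ≤ M := Nat.le_ceil _
    have hMle : (M : ℝ) ≤ 2 * Real.log X := by
      have := Nat.ceil_lt_add_one hlogX0.le
      linarith
    have hM1 : (1 : ℝ) ≤ M := hlog1.trans hMge
    have hmle : m * Real.log X ≤ e / (8 * 10 ^ 6) * X := by
      rw [← le_div_iff₀ hlogX0, mul_div_assoc]
      refine hlt.le.trans ?_
      gcongr
      exact min_le_left _ _
    refine hA.contradiction (by rw [hX] at hX8; exact_mod_cast hX8) hε hε1 (M := M)
      (by exact_mod_cast hM1) ?_ ?_ ?_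
    · rw [← hX, ← Real.log_le_iff_le_exp (by linarith)]
      exact hMge
    · rw [← hX, ← he, div_le_iff₀ (by positivity)]
      have : (M : ℝ) ^ 2 ≤ (2 * Real.log X) ^ 2 := by gcongr
      linarith
    · rw [← hX, ← he, mul_div_assoc', div_le_iff₀ (by positivity)]
      have h1 : (m : ℝ) * M ≤ m * (2 * Real.log X) := by gcongr
      have h2 : (m : ℝ) * M ≤ 2 * (e / (8 * 10 ^ 6) * X) := by linarith
      have h3 := mul_le_mul_of_nonneg_right h2 (by positivity : (0 : ℝ) ≤ 4 * 10 ^ 6 * M)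
      linarith
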